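/- Let $F$ be a non-archimedean local field of residue characteristic $p$, let $\mathcal H$ be a connected reductive linear algebraic group defined over $F$, and let $G$ be its group of $F$-rational points. Let $P,\bar P$ be opposite parabolic subgroups defined over $F$, with unipotent radicals $U,\bar U$ and common Levi subgroup $M=P\cap\bar P$; we use the same letters for the groups of $F$-rational points. Fix a left Haar measure $\mu$ on $G$ with $\mu(K)\in p^{\mathbb Z}$ for every compact open pro-$p$ subgroup $K$. Let $R$ be a unital ring in which $p$ is invertible, let $H(G)$ be the convolution algebra of locally constant, compactly supported functions $G\to R$, and let $e_K=\mu(K)^{-1}1_K$ for a compact open pro-$p$ subgroup $K$. *Notation.* A compact open subgroup $K\subseteq G$ is *well-placed* if it is a pro-$p$-group and the multiplication map $(K\cap U)\times(K\cap M)\times(K\cap\bar U)\to K$ is bijective, as well as its analogues for all other orderings of the three factors. For such a $K$, an element $\lambda$ of the centre of $M$ is *strictly positive* if $\lambda(K\cap U)\lambda^{-1}\supseteq K\cap U$, $\lambda(K\cap\bar U)\lambda^{-1}\subseteq K\cap\bar U$, $$\bigcup_{n}\lambda^n(K\cap U)\lambda^{-n}=U,\quad \bigcap_{n}\lambda^{-n}(K\cap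 U)\lambda^{n}=\{1\},\quad \bigcup_{n}\lambda^{-n}(K\cap\bar U)\lambda^{n}=\bar U,\quad \bigcap_{n}\lambda^{n}(K\cap\bar U)\lambda^{-n}=\{1\}.$$ Put $e_{K\lambda K}=e_K\lambda e_K\in H(G)$. For a smooth representation $V$ of $G$ on an $R$-module, let $\mathrm{Rough}(V)=\varprojlim_K V^K$, the limit being over the compact open pro-$p$ subgroups with transition maps $e_L\colon V^K\to V^L$ for $K\subseteq L$. Let $i^{*}_{P}(V)\subseteq\mathrm{Rough}(V)$ be the set of $M$-smooth $U$-invariant elements, and let $r^{\bar P}(V)$ be the module of $\bar U$-coinvariants of $V$. (The usual twists by $\delta_P^{-1/2}=\delta_{\bar P}^{1/2}$ are omitted; they are trivial on compact subgroups of $M$ and affect none of the following.) The natural map $i^{*}_{P}(V)\to r^{\bar P}(V)$ sends $v$ to the class of $e_Lv\in V^L$, for any well-placed $L$ such that $v$ is $(L\cap M)$-invariant. Exchanging the roles of $P$ and $\bar P$ gives the natural map $i^{*}_{\bar P}(V)\to r^{P}(V)$. A module endomorphism $T$ is *stable* if $\ker T=\ker T^2$ and $\operatorname{im}T=\operatorname{im}T^2$.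 For a map $T\colon W\to W$, let $\varprojlim T$ and $\varinjlim T$ be the limits of the system $\cdots\to W\to W\to W\to\cdots$ with all maps equal to $T$; the natural map $\varprojlim T\to\varinjlim T$ sends $(x_n)_n$ to the class of $x_0$. Let $G$ act on $H(G)$ by the (left) regular representation. **Statement.** Let $K$ be well-placed and let $\lambda$ be strictly positive. 1. Let $T_l,T_r$ be left and right multiplication by $e_{K\lambda K}$ on $H(G)$. If the natural maps $\varprojlim T_l\to\varinjlim T_l$ and $\varprojlim T_r\to\varinjlim T_r$ are bijective, then for all sufficiently large $n$ $$e_{K\lambda K}^nH(G)=e_{K\lambda K}^{n+1}H(G)\quad\text{and}\quad H(G)e_{K\lambda K}^n=H(G)e_{K\lambda K}^{n+1}.\qquad(*)$$ 2. If $n\ge1$ satisfies $(*)$, then $e_{K\lambda K}^n$ acts by a stable operator on every smooth representation of $G$ on an $R$-module. 3. Suppose that the natural maps restrict to bijections $i^{*}_{P}(H(G))^{K\cap M}\to r^{\bar P}(H(G))^{K\cap M}$ and $i^{*}_{\bar P}(H(G))^{K\cap M}\to r^{P}(H(G))^{K\cap M}$. Then there is $n_0$ such that for all $n\ge n_0$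 the equalities $(*)$ hold and $e_{K\lambda K}^n$ is stable on every smooth representation of $G$ on an $R$-module; $n_0$ does not depend on the representation. Consequently, Second Adjointness implies Stabilisation: if the natural maps $i^{*}_{P}(H(G))\to r^{\bar P}(H(G))$ and $i^{*}_{\bar P}(H(G))\to r^{P}(H(G))$ are bijective, then the conclusion of 3 holds for all well-placed $K$ and all strictly positive $\lambda$. -/

import Mathlib

open scoped Pointwise Topology MatrixGroups ValuativeRel

noncomputable section

namespace StabAdj

/-! ### Linear algebraic groups over `k`, as Zariski closed subgroups of `GL_n(k)` -/

section Algebraic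

variable {n : ℕ} {k : Type*} [Field k]

/-- The value of a polynomial in the matrix entries at an invertible matrix. -/
def evalGL (g : GL (Fin n) k) (f : MvPolynomial (Fin n × Fin n) k) : k :=
  MvPolynomial.eval (fun ij => (g : Matrix (Fin n) (Fin n) k) ij.1 ij.2) f

/-- Zariski closed subsets of `GL_n(k)`. (As the determinant is invertible on `GL_n`, it suffices
to use polynomials in the matrix entries.) -/
def ZariskiClosed (X : Set (GL (Fin n) k)) : Prop :=
  ∃ S : Set (MvPolynomial (Fin n × Fin n) k), X = {g | ∀ f ∈ S, evalGL g f = 0}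

/-- Connectedness in the Zariski topology. -/
def ZariskiConnected (X : Set (GL (Fin n) k)) : Prop :=
  ∀ Y Z : Set (GL (Fin n) k), ZariskiClosed Y → ZariskiClosed Z → Y ∪ Z = X → Disjoint Y Z →
    Y = ∅ ∨ Z = ∅

/-- The ideal of polynomials vanishing on `X`. -/
def vanishing (X : Set (GL (Fin n) k)) : Ideal (MvPolynomial (Fin n × Fin n) k) where
  carrier := {f | ∀ g ∈ X, evalGL g f = 0}
  add_mem' := fun {a b} ha hb g hg => by
    have h1 := ha g hg
    have h2 := hb g hg
    simp only [evalGL] at h1 h2 ⊢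
    rw [map_add, h1, h2, add_zero]
  zero_mem' := fun g _ => by simp [evalGL]
  smul_mem' := fun c a ha g hg => by
    have h1 := ha g hg
    simp only [evalGL] at h1 ⊢
    rw [smul_eq_mul, map_mul, h1, mul_zero]

/-- `X` is defined over the subfield `F`: its ideal is generated by polynomials with
coefficients in `F`. -/
def DefinedOver (F : Type*) [Field F] [Algebra F k] (X : Set (GL (Fin n) k)) : Prop :=
  vanishing X = Ideal.span {f | f ∈ vanishing X ∧
    ∃ f₀ : MvPolynomial (Fin n × Fin n) F, MvPolynomial.map (algebraMap F k) f₀ = f}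

/-- All elements of `H` are unipotent matrices. -/
def IsUnipotentGroup (H : Subgroup (GL (Fin n) k)) : Prop :=
  ∀ g ∈ H, IsNilpotent ((g : Matrix (Fin n) (Fin n) k) - 1)

/-- `U` is a connected closed normal unipotent subgroup of `H`. -/
def IsConnectedNormalUnipotent (H U : Subgroup (GL (Fin n) k)) : Prop :=
  U ≤ H ∧ (∀ h ∈ H, ∀ u ∈ U, h * u * h⁻¹ ∈ U) ∧
    ZariskiClosed (U : Set (GL (Fin n) k)) ∧ ZariskiConnected (U : Set (GL (Fin n) k)) ∧
    IsUnipotentGroup U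

/-- `U` is the unipotent radical of `H`: the largest connected closed normal unipotent
subgroup. -/
def IsUnipotentRadical (H U : Subgroup (GL (Fin n) k)) : Prop :=
  IsConnectedNormalUnipotent H U ∧ ∀ U', IsConnectedNormalUnipotent H U' → U' ≤ U

/-- Borel subgroups: maximal connected closed solvable subgroups. -/
def IsBorel (H B : Subgroup (GL (Fin n) k)) : Prop :=
  Maximal (fun B' : Subgroup (GL (Fin n) k) => B' ≤ H ∧
    ZariskiClosed (B' : Set (GL (Fin n) k)) ∧ ZariskiConnected (B' : Set (GL (Fin n) k)) ∧
    Group.IsSolvable B') B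

/-- Parabolic subgroups: closed subgroups containing a Borel subgroup. -/
def IsParabolic (H P : Subgroup (GL (Fin n) k)) : Prop :=
  P ≤ H ∧ ZariskiClosed (P : Set (GL (Fin n) k)) ∧ ∃ B, IsBorel H B ∧ B ≤ P

/-- `M` is a Levi subgroup of `P`, where `U` is the unipotent radical of `P`: `P = M ⋉ U`. -/
def IsLevi (P U M : Subgroup (GL (Fin n) k)) : Prop :=
  M ≤ P ∧ ZariskiClosed (M : Set (GL (Fin n) k)) ∧ M ⊓ U = ⊥ ∧
    ∀ x ∈ P, ∃ m ∈ M, ∃ u ∈ U, x = m * u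

/-- A connected reductive linear algebraic group (over the algebraically closed field `k`),
defined over `F`. -/
def IsConnectedReductive (F : Type*) [Field F] [Algebra F k] (H : Subgroup (GL (Fin n) k)) :
    Prop :=
  ZariskiClosed (H : Set (GL (Fin n) k)) ∧ DefinedOver F (H : Set (GL (Fin n) k)) ∧
    ZariskiConnected (H : Set (GL (Fin n) k)) ∧ IsUnipotentRadical H ⊥

/-- `P` and `P'` are opposite parabolic subgroups of `H` defined over `F`, with unipotent
radicals `U` and `U'`: their intersection `M` is a Levi subgroup of both. -/
structure IsOppositePair (F : Type*) [Field F] [Algebra F k]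
    (H P P' U M U' : Subgroup (GL (Fin n) k)) : Prop where
  parabolic : IsParabolic H P
  parabolic' : IsParabolic H P'
  definedOver : DefinedOver F (P : Set (GL (Fin n) k))
  definedOver' : DefinedOver F (P' : Set (GL (Fin n) k))
  radical : IsUnipotentRadical P U
  radical' : IsUnipotentRadical P' U'
  inter : M = P ⊓ P'
  levi : IsLevi P U M
  levi' : IsLevi P' U' M

/-- The group of `F`-rational points, as a subgroup of `GL_n(F)`. -/
def ratPoints (F : Type*) [Field F] [Algebra F k] (H : Subgroup (GL (Fin n) k)) :
    Subgroup (GL (Fin n) F) :=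
  H.comap (Matrix.GeneralLinearGroup.map (algebraMap F k))

/-- For `L ≤ H`, the rational points of `L` as a subgroup of the rational points of `H`. -/
def ratSub (F : Type*) [Field F] [Algebra F k] (H L : Subgroup (GL (Fin n) k)) :
    Subgroup (ratPoints F H) :=
  (ratPoints F L).subgroupOf (ratPoints F H)

end Algebraic

/-! ### Compact open pro-`p` subgroups, Haar measure and the Hecke algebra -/

section Hecke

variable {G : Type*} [Group G] [TopologicalSpace G]

/-- `K` is a compact open subgroup that is a pro-`p`-group. -/
def IsOpenProP (p : ℕ) (K : Subgroup G) : Prop :=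
  IsOpen (K : Set G) ∧ IsCompact (K : Set G) ∧
    ∀ L : Subgroup G, IsOpen (L : Set G) → L ≤ K → ∃ a : ℕ, L.relIndex K = p ^ a

/-- The volume of a compact open pro-`p` subgroup `K`, viewed as a unit of `R`: it is `p ^ a`
for the integer `a` with `μ K = p ^ a`. -/
def vol [MeasurableSpace G] (μ : MeasureTheory.Measure G) {p : ℕ} {R : Type*} [Ring R]
    (hp : IsUnit (p : R)) (K : Subgroup G) : Rˣ :=
  hp.unit ^ (Classical.epsilon fun a : ℤ => μ (K : Set G) = (p : ENNReal) ^ a)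

open Classical in
/-- The integral `∫ φ dμ` of a locally constant, compactly supported function `φ` with values in
an `R`-module: if `φ` is constant on the left cosets `x L` of a compact open pro-`p` subgroup `L`,
it is the volume of `L` times the finite sum of the values of `φ` on the cosets. -/
def haarInt [MeasurableSpace G] (μ : MeasureTheory.Measure G) {p : ℕ} {R : Type*} [Ring R]
    (hp : IsUnit (p : R)) {V : Type*} [AddCommGroup V] [Module R V] (φ : G → V) : V :=
  if h : ∃ L : Subgroup G, IsOpenProP p L ∧ ∀ x, ∀ l ∈ L, φ (x * l) = φ x then
    (vol μ hp h.choose : R) • ∑ᶠ q : G ⧸ h.choose, φ q.out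
  else 0

/-- The locally constant, compactly supported functions `G → R`. -/
def Hecke (G : Type*) [Group G] [TopologicalSpace G] (R : Type*) [Ring R] :
    Submodule R (G → R) where
  carrier := {f | IsLocallyConstant f ∧ HasCompactSupport f}
  add_mem' := fun ha hb => ⟨ha.1.add hb.1, ha.2.add hb.2⟩
  zero_mem' := ⟨IsLocallyConstant.const 0, HasCompactSupport.zero⟩
  smul_mem' := fun c f hf => ⟨hf.1.comp (fun r => c * r), by
    exact hf.2.comp_left (g := fun r => c * r) (mul_zero c)⟩

variable [IsTopologicalGroup G] {R : Type*} [Ring R]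

/-- The left regular representation, `(g f)(x) = f(g⁻¹ x)`. -/
def leftReg (G : Type*) [Group G] [TopologicalSpace G] [IsTopologicalGroup G] (R : Type*)
    [Ring R] : G →* Module.End R (Hecke G R) where
  toFun g :=
    { toFun := fun f => ⟨fun x => f.1 (g⁻¹ * x),
        f.2.1.comp_continuous (continuous_const_mul g⁻¹),
        f.2.2.comp_homeomorph (Homeomorph.mulLeft g⁻¹)⟩
      map_add' := fun _ _ => rfl
      map_smul' := fun _ _ => rfl }
  map_one' := by
    ext f x
    simp
  map_mul' g h := by
    ext f x
    simp [mul_assoc]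

variable [MeasurableSpace G] (μ : MeasureTheory.Measure G) {p : ℕ} (hp : IsUnit (p : R))

/-- Convolution, `(f * h)(g) = ∫ f(x) h(x⁻¹ g) dμ(x)`: the multiplication of the Hecke algebra. -/
def conv (f h : Hecke G R) : Hecke G R :=
  ⟨fun g => haarInt μ hp fun x => f.1 x * h.1 (x⁻¹ * g), by
    constructor
    · rw [IsLocallyConstant.iff_eventually_eq]
      intro g₀
      have key : ∀ᶠ g in 𝓝 g₀, ∀ x ∈ tsupport f.1, h.1 (x⁻¹ * g) = h.1 (x⁻¹ * g₀) := by
        apply IsCompact.eventually_forall_of_forall_eventually f.2.2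
        intro x _
        have h1 : IsLocallyConstant fun z : G × G => h.1 (z.2⁻¹ * z.1) :=
          h.2.1.comp_continuous (by fun_prop)
        have h2 : IsLocallyConstant fun z : G × G => h.1 (z.2⁻¹ * g₀) :=
          h.2.1.comp_continuous (by fun_prop)
        filter_upwards [(IsLocallyConstant.iff_eventually_eq _).1 h1 (g₀, x),
          (IsLocallyConstant.iff_eventually_eq _).1 h2 (g₀, x)] with z hz1 hz2
        rw [hz1, hz2]
      filter_upwards [key] with g hg
      congr 1
      funext x
      by_cases hx : x ∈ tsupport f.1
      · rw [hg x hx]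
      · rw [image_eq_zero_of_notMem_tsupport hx, zero_mul, zero_mul]
    · apply HasCompactSupport.intro (IsCompact.mul f.2.2 h.2.2)
      intro g hg
      have h0 : (fun x => f.1 x * h.1 (x⁻¹ * g)) = fun _ => (0 : R) := by
        funext x
        by_cases hx : x ∈ tsupport f.1
        · have : x⁻¹ * g ∉ tsupport h.1 := fun hh =>
            hg ⟨x, hx, x⁻¹ * g, hh, by simp⟩
          rw [image_eq_zero_of_notMem_tsupport this, mul_zero]
        · rw [image_eq_zero_of_notMem_tsupport hx, zero_mul]
      rw [h0]
      unfold haarInt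
      split_ifs <;> simp⟩

/-- Positive powers for convolution: `convPow f m` is `f ^ (m + 1)`. -/
def convPow (f : Hecke G R) : ℕ → Hecke G R
  | 0 => f
  | m + 1 => conv μ hp f (convPow f m)

/-- The idempotent `e_K`: the characteristic function of `K` divided by the volume of `K`. -/
def idem (K : Subgroup G) (hK : IsOpenProP p K) : Hecke G R :=
  ⟨Set.indicator (K : Set G) fun _ => ((vol μ hp K)⁻¹ : Rˣ), by
    have hcl : IsClosed (K : Set G) := K.isClosed_of_isOpen hK.1
    constructor
    · rw [IsLocallyConstant.iff_eventually_eq]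
      intro x
      by_cases hx : x ∈ (K : Set G)
      · filter_upwards [hK.1.mem_nhds hx] with y hy
        simp [Set.indicator_of_mem hx, Set.indicator_of_mem hy]
      · filter_upwards [hcl.isOpen_compl.mem_nhds hx] with y hy
        rw [Set.indicator_of_notMem hx, Set.indicator_of_notMem hy]
    · exact HasCompactSupport.intro hK.2.1 fun x hx => Set.indicator_of_notMem hx _⟩

/-- `e_{K g K} = e_K g e_K`. -/
def dblIdem (K : Subgroup G) (hK : IsOpenProP p K) (g : G) : Hecke G R :=
  conv μ hp (idem μ hp K hK) (leftReg G R g (idem μ hp K hK))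

variable {V : Type*} [AddCommGroup V] [Module R V] (π : G →* Module.End R V)

/-- A representation on an `R`-module is smooth if each vector is fixed by an open subgroup. -/
def IsSmooth : Prop :=
  ∀ v : V, ∃ L : Subgroup G, IsOpen (L : Set G) ∧ ∀ l ∈ L, π l v = v

/-- The action of the Hecke algebra, `f v = ∫ f(x) π(x) v dμ(x)`. -/
def heckeAct (f : Hecke G R) (v : V) : V :=
  haarInt μ hp fun x => f.1 x • π x v

/-- `T` is stable: `ker T = ker T²` and `im T = im T²`. -/
def IsStable {W : Type*} [AddCommGroup W] (T : W → W) : Prop :=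
  {w | T w = 0} = {w | T (T w) = 0} ∧ Set.range T = Set.range fun w => T (T w)

/-- The right ideals generated by `e ^ (m + 1)` and `e ^ (m + 2)` agree, and so do the left
ideals. -/
def IdealsAgree (e : Hecke G R) (m : ℕ) : Prop :=
  Set.range (fun f => conv μ hp (convPow μ hp e m) f) =
      Set.range (fun f => conv μ hp (convPow μ hp e (m + 1)) f) ∧
    Set.range (fun f => conv μ hp f (convPow μ hp e m)) =
      Set.range (fun f => conv μ hp f (convPow μ hp e (m + 1)))

end Hecke

/-! ### Limits of constant systems -/

section Limits

variable {W : Type*} (T : W → W)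

/-- The projective limit of `⋯ → W → W → W` with all maps equal to `T`. -/
def ProjLim : Type _ := {x : ℕ → W // ∀ i, T (x (i + 1)) = x i}

/-- The inductive limit of `W → W → W → ⋯` with all maps equal to `T`: `(i, w)` is the class of
`w` in the `i`-th copy of `W`. -/
def IndLim : Type _ := Quot fun a b : ℕ × W => b = (a.1 + 1, T a.2)

/-- The natural map from the projective to the inductive limit. -/
def limMap (x : ProjLim T) : IndLim T := Quot.mk _ (0, x.1 0)

end Limits

/-! ### Well-placed subgroups, positive elements and the Jacquet functors -/

section Jacquet

variable {G : Type*} [Group G]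

/-- The multiplication map `(K ∩ A) × (K ∩ B) × (K ∩ C) → K` is bijective. -/
def MulBijective (K A B C : Subgroup G) : Prop :=
  Function.Bijective fun t : ↥(K ⊓ A) × ↥(K ⊓ B) × ↥(K ⊓ C) =>
    (⟨t.1.1 * t.2.1.1 * t.2.2.1,
      K.mul_mem (K.mul_mem t.1.2.1 t.2.1.2.1) t.2.2.2.1⟩ : K)

/-- `K` is a compact open pro-`p` subgroup in good position with respect to `U`, `M`, `U'`. -/
def WellPlaced [TopologicalSpace G] (p : ℕ) (U M U' K : Subgroup G) : Prop :=
  IsOpenProP p K ∧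
    MulBijective K U M U' ∧ MulBijective K U U' M ∧ MulBijective K M U U' ∧
    MulBijective K M U' U ∧ MulBijective K U' U M ∧ MulBijective K U' M U

/-- `z` is a central element of `M` that is strictly positive: conjugation by `z` expands `K ∩ U`
to all of `U` and contracts `K ∩ U'` to `1`, and conjugation by `z⁻¹` does the opposite. -/
structure StrictlyPositive (U M U' K : Subgroup G) (z : G) : Prop where
  mem : z ∈ M
  central : ∀ m ∈ M, z * m = m * z
  mono : ∀ u ∈ K ⊓ U, z⁻¹ * u * z ∈ K ⊓ U
  mono' : ∀ u ∈ K ⊓ U', z * u * z⁻¹ ∈ K ⊓ U'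
  iUnion : ⋃ i : ℕ, (fun u => z ^ i * u * (z ^ i)⁻¹) '' ((K ⊓ U : Subgroup G) : Set G) = U
  iInter : ⋂ i : ℕ, (fun u => (z ^ i)⁻¹ * u * z ^ i) '' ((K ⊓ U : Subgroup G) : Set G) = {1}
  iUnion' : ⋃ i : ℕ, (fun u => (z ^ i)⁻¹ * u * z ^ i) '' ((K ⊓ U' : Subgroup G) : Set G) = U'
  iInter' : ⋂ i : ℕ, (fun u => z ^ i * u * (z ^ i)⁻¹) '' ((K ⊓ U' : Subgroup G) : Set G) = {1}

variable [TopologicalSpace G] [IsTopologicalGroup G] [MeasurableSpace G]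
  (μ : MeasureTheory.Measure G) {p : ℕ} {R : Type*} [Ring R] (hp : IsUnit (p : R))
  {V : Type*} [AddCommGroup V] [Module R V] (π : G →* Module.End R V)

/-- The roughening of `V`: the projective limit of the invariants `V^K` over the compact open
pro-`p` subgroups `K`, with transition maps `e_L : V^K → V^L` for `K ≤ L`. -/
def Rough : Type _ :=
  {v : {K : Subgroup G // IsOpenProP p K} → V //
    (∀ K, ∀ x ∈ K.1, π x (v K) = v K) ∧
    ∀ K L, K.1 ≤ L.1 → heckeAct μ hp π (idem μ hp L.1 L.2) (v K) = v L}

/-- `g v = v` for the canonical `G`-action on the roughening,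
`(g v)_{g K g⁻¹} = π(g) v_K`. -/
def RoughFixed (v : Rough μ hp π) (g : G) : Prop :=
  ∀ K L : {K : Subgroup G // IsOpenProP p K}, (∀ x, x ∈ K.1 ↔ g * x * g⁻¹ ∈ L.1) →
    π g (v.1 K) = v.1 L

/-- The adjoint functor `i*` for `P = M U`: the `M`-smooth, `U`-invariant elements of the
roughening. The usual twist of the `M`-action by a square root of the modular function is an
unramified character, trivial on compact subgroups; it changes neither the underlying module, nor
the subspaces of invariants of compact subgroups of `M`, nor the natural map, and is left out. -/
def iStar (U M : Subgroup G) : Set (Rough μ hp π) :=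
  {v | (∀ u ∈ U, RoughFixed μ hp π v u) ∧ ∃ N ∈ 𝓝 (1 : G), ∀ m ∈ M, m ∈ N → RoughFixed μ hp π v m}

/-- The elements of `i*` that are invariant under `K ∩ M`. -/
def iStarInv (U M K : Subgroup G) : Set (Rough μ hp π) :=
  {v | v ∈ iStar μ hp π U M ∧ ∀ m ∈ K ⊓ M, RoughFixed μ hp π v m}

/-- The Jacquet restriction for the parabolic subgroup `M U'`: the `U'`-coinvariants of `V` (with
the twist left out as above). -/
abbrev Coinv (U' : Subgroup G) : Type _ :=
  V ⧸ Submodule.span R {x : V | ∃ u ∈ U', ∃ v : V, x = π u v - v}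

/-- The class of a vector in the coinvariants. -/
def toCoinv (U' : Subgroup G) (v : V) : Coinv π U' := Submodule.Quotient.mk v

/-- The invariants of `K ∩ M` in the Jacquet restriction, for the `M`-action `m [v] = [π(m) v]`. -/
def coinvInv (M U' K : Subgroup G) : Set (Coinv π U') :=
  {w | ∀ m ∈ K ⊓ M, ∀ v : V, toCoinv π U' v = w → toCoinv π U' (π m v) = w}

open Classical in
/-- The natural map from `i*` to the Jacquet restriction: if `v` is invariant under `L ∩ M` with
`L` in good position, it sends `v` to the class of `e_L v = v_L`, which does not depend on `L`. -/
def natMap (U M U' : Subgroup G) (v : Rough μ hp π) : Coinv π U' :=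
  if h : ∃ L : {K : Subgroup G // IsOpenProP p K},
      WellPlaced p U M U' L.1 ∧ ∀ m ∈ L.1 ⊓ M, RoughFixed μ hp π v m then
    toCoinv π U' (v.1 h.choose)
  else 0

/-- The natural map `i* → r` is invertible. -/
def AdjIso (U M U' : Subgroup G) : Prop :=
  Set.BijOn (natMap μ hp π U M U') (iStar μ hp π U M) Set.univ

/-- The natural map restricts to an invertible map between the `K ∩ M`-invariants. -/
def AdjIsoInv (U M U' K : Subgroup G) : Prop :=
  Set.BijOn (natMap μ hp π U M U') (iStarInv μ hp π U M K) (coinvInv π M U' K)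

end Jacquet

end StabAdj

end

set_option linter.unusedSectionVars false

noncomputable section

namespace StabAdj

/-! ### Compact open pro-`p` subgroups -/

section ProP

variable {G : Type*} [Group G]

/-! Write `e` for `e_{K z K}`; the idempotent `e_K` is a two-sided unit for `e`. Both equalities of
ideals come down to identities `e ^ m = e ^ (m + 1) * x` and `e ^ m = y * e ^ (m + 1)`, which
persist for all larger exponents. Iterating them gives `e ^ m = e ^ (2 m) * x' = y' * e ^ (2 m)`. On
a smooth representation the first form shows that the image of `e ^ m` is that of its square, the
second does the same for the kernel, and neither `x'` nor `y'` depends on the representation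
(`isStable_of_idealsAgree`).

It is therefore enough to solve `e ^ n * (e * x) = e ^ n * e_K` and its mirror image. For the limits
this is surjectivity at the class of `e_K`: a preimage is a sequence whose term of index 1 is the
required `x` (`exists_iterate_eq_of_limMap_surjective`).

For the natural maps, choose `v` in the roughening of the regular representation, invariant under
`U` and `K ∩ M`, with image the class of `e_K`. Three facts combine in `exists_iterate_eq`. By
`dblIdem_rough`, `v_K` lies in the image of `e`. By `iterate_dblIdem`, `e ^ n` acts as `e_K z ^ n`
on `K`-fixed vectors. By `exists_idem_pow_eq_zero`, `e_K z ^ n` kills a vector of trivial class in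
the `U'`-coinvariants once `n` is large, because `z ^ n` moves any given element of `U'` into `K`.
Applied to `v_K - e_K`, they give `e ^ n v_K = e ^ n e_K` with `v_K = e x`.

Right multiplication reduces to left multiplication: inversion on `G` turns it, up to a central unit
from the modular character, into left multiplication by `e_{K z⁻¹ K}`, and `z⁻¹` is strictly
positive for the opposite parabolic (`iterate_eq_flip`).

Under full second adjointness, the preimage of the class of `e_K` is `K ∩ M`-invariant by
equivariance and injectivity (`AdjIso.mem_image`). Computing the natural map there needs well-placed
subgroups with small `M`-part, which `exists_wellPlaced_small` builds from `K` and `z`. -/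

/-- The conjugate subgroup `g K g⁻¹`. -/
def conjSub (g : G) (K : Subgroup G) : Subgroup G := K.comap (MulAut.conj g⁻¹).toMonoidHom

theorem mem_conjSub {g x : G} {K : Subgroup G} : x ∈ conjSub g K ↔ g⁻¹ * x * g ∈ K := by
  simp [conjSub, Subgroup.mem_comap]

theorem coe_conjSub (g : G) (K : Subgroup G) :
    (conjSub g K : Set G) = (fun x => g * x * g⁻¹) '' (K : Set G) := by
  ext x
  simp only [SetLike.mem_coe, mem_conjSub, Set.mem_image]
  constructor
  · intro h
    exact ⟨_, h, by group⟩
  · rintro ⟨y, hy, rfl⟩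
    simpa [mul_assoc] using hy

theorem conjSub_mono {g : G} {K L : Subgroup G} (h : K ≤ L) : conjSub g K ≤ conjSub g L :=
  Subgroup.comap_mono h

theorem conjSub_conjSub (g h : G) (K : Subgroup G) :
    conjSub g (conjSub h K) = conjSub (g * h) K := by
  ext x
  simp [mem_conjSub, mul_assoc]

theorem conjSub_one (K : Subgroup G) : conjSub 1 K = K := by
  ext x
  simp [mem_conjSub]

theorem conjSub_inv_conjSub (g : G) (K : Subgroup G) : conjSub g⁻¹ (conjSub g K) = K := by
  simp [conjSub_conjSub, conjSub_one]

theorem relIndex_conjSub (g : G) (J K : Subgroup G) :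
    (conjSub g J).relIndex (conjSub g K) = J.relIndex K := by
  rw [conjSub, Subgroup.relIndex_comap]
  congr 1
  exact Subgroup.map_comap_eq_self_of_surjective (MulAut.conj g⁻¹).surjective K

variable [TopologicalSpace G] {p : ℕ}

theorem IsOpenProP.mono [IsTopologicalGroup G] (hp : p.Prime) {K L : Subgroup G}
    (hK : IsOpenProP p K) (hL : IsOpen (L : Set G)) (h : L ≤ K) : IsOpenProP p L := by
  refine ⟨hL, hK.2.1.of_isClosed_subset (L.isClosed_of_isOpen hL) h, fun J hJ hJL => ?_⟩
  obtain ⟨a, ha⟩ := hK.2.2 J hJ (hJL.trans h)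
  have h1 : J.relIndex L ∣ p ^ a := by
    rw [← ha, ← Subgroup.relIndex_mul_relIndex J L K hJL h]
    exact Dvd.intro _ rfl
  obtain ⟨b, -, hb⟩ := (Nat.dvd_prime_pow hp).1 h1
  exact ⟨b, hb⟩

theorem IsOpenProP.relIndex_ne_zero (hp : p.Prime) {J K : Subgroup G} (hK : IsOpenProP p K)
    (hJ : IsOpen (J : Set G)) (h : J ≤ K) : J.relIndex K ≠ 0 := by
  obtain ⟨a, ha⟩ := hK.2.2 J hJ h
  rw [ha]
  exact pow_ne_zero _ hp.ne_zero

theorem isOpen_conjSub [IsTopologicalGroup G] (g : G) {K : Subgroup G} (hK : IsOpen (K : Set G)) :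
    IsOpen (conjSub g K : Set G) := by
  have : (conjSub g K : Set G) = (fun x => g⁻¹ * x * g) ⁻¹' (K : Set G) := by
    ext x; simp [mem_conjSub]
  rw [this]
  exact hK.preimage (by fun_prop)

theorem IsOpenProP.conjSub [IsTopologicalGroup G] (g : G) {K : Subgroup G}
    (hK : IsOpenProP p K) : IsOpenProP p (conjSub g K) := by
  refine ⟨isOpen_conjSub g hK.1, ?_, fun L hL hLK => ?_⟩
  · rw [coe_conjSub]
    exact hK.2.1.image (by fun_prop)
  · obtain ⟨a, ha⟩ := hK.2.2 _ (isOpen_conjSub g⁻¹ hL)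
      ((conjSub_mono hLK).trans (conjSub_inv_conjSub g K).le)
    refine ⟨a, ?_⟩
    rw [← ha, ← relIndex_conjSub g⁻¹, conjSub_inv_conjSub]

/-- The normal core of `J ⊓ K` in `K` has finite index because that of `J ⊓ K` is a power of `p`;
being closed as well, it is open. -/
theorem IsOpenProP.exists_normal_le [IsTopologicalGroup G] (hp : p.Prime) {K J : Subgroup G}
    (hK : IsOpenProP p K) (hJ : IsOpen (J : Set G)) :
    ∃ N : Subgroup G, IsOpenProP p N ∧ N ≤ J ∧ N ≤ K ∧ ∀ k ∈ K, ∀ x ∈ N, k * x * k⁻¹ ∈ N := by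
  have hJK : IsOpen ((J ⊓ K : Subgroup G) : Set G) := hJ.inter hK.1
  have hfin : ((J ⊓ K).subgroupOf K).FiniteIndex :=
    ⟨hK.relIndex_ne_zero hp hJK inf_le_right⟩
  set N' := ((J ⊓ K).subgroupOf K).normalCore with hN'
  have hcl : IsClosed (N' : Set K) := by
    apply Subgroup.normalCore_isClosed
    apply Subgroup.isClosed_of_isOpen
    exact hJK.preimage continuous_subtype_val
  have hop : IsOpen (N' : Set K) := Subgroup.isOpen_of_isClosed_of_finiteIndex _ hcl
  have hopN : IsOpen (N'.map K.subtype : Set G) := by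
    rw [Subgroup.coe_map]
    exact hK.1.isOpenMap_subtype_val _ hop
  have hle : N'.map K.subtype ≤ K := by
    rintro _ ⟨x, -, rfl⟩
    exact x.2
  refine ⟨N'.map K.subtype, hK.mono hp hopN hle, ?_, hle, ?_⟩
  · rintro _ ⟨x, hx, rfl⟩
    have := Subgroup.normalCore_le _ hx
    exact (Subgroup.mem_subgroupOf.1 this).1
  · rintro k hk _ ⟨x, hx, rfl⟩
    refine ⟨⟨k, hk⟩ * x * ⟨k, hk⟩⁻¹, ?_, rfl⟩
    exact (Subgroup.normalCore_normal _).conj_mem x hx _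

end ProP

/-! ### Haar measures with values in `p ^ ℤ` on groups with small pro-`p` subgroups -/

/-- A left invariant measure on a group with arbitrarily small compact open pro-`p` subgroups,
whose values on these subgroups are powers of `p`. -/
class ProPHaar {G : Type*} [Group G] [TopologicalSpace G] [MeasurableSpace G]
    (p : ℕ) (μ : MeasureTheory.Measure G) : Prop where
  prime : p.Prime
  small : ∀ s ∈ 𝓝 (1 : G), ∃ L : Subgroup G, IsOpenProP p L ∧ (L : Set G) ⊆ s
  measure_eq : ∀ K : Subgroup G, IsOpenProP p K → ∃ a : ℤ, μ (K : Set G) = (p : ENNReal) ^ a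
  invariant : μ.IsMulLeftInvariant

section Haar

variable {G : Type*} [Group G] [TopologicalSpace G] [IsTopologicalGroup G] [MeasurableSpace G]
  [BorelSpace G] {p : ℕ} (μ : MeasureTheory.Measure G) [ProPHaar p μ] {R : Type*} [Ring R]
  (hp : IsUnit (p : R))

theorem exists_proP_le (μ : MeasureTheory.Measure G) [ProPHaar p μ] {s : Subgroup G} (hs : IsOpen (s : Set G)) :
    ∃ L : Subgroup G, IsOpenProP p L ∧ L ≤ s :=
  ProPHaar.small (p := p) (μ := μ) _ (hs.mem_nhds s.one_mem)

theorem measure_eq_relIndex_mul {J K : Subgroup G} (hJ : IsOpen (J : Set G))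
    (hK : IsOpenProP p K) (h : J ≤ K) :
    μ (K : Set G) = J.relIndex K * μ (J : Set G) := by
  have := ProPHaar.invariant (p := p) (μ := μ)
  have hfin : (J.subgroupOf K).FiniteIndex :=
    ⟨hK.relIndex_ne_zero (ProPHaar.prime μ) hJ h⟩
  obtain ⟨s, hs, -⟩ := (J.subgroupOf K).exists_isComplement_left 1
  have hs' : Finite s := hs.finite_left_iff.mpr inferInstance
  have hU : (K : Set G) = ⋃ a : s, (a.1 : G) • (J : Set G) := by
    ext x
    simp only [SetLike.mem_coe, Set.mem_iUnion, Set.mem_smul_set]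
    constructor
    · intro hx
      obtain ⟨⟨a, b⟩, hab, -⟩ := hs.existsUnique ⟨x, hx⟩
      refine ⟨a, b.1, Subgroup.mem_subgroupOf.1 b.2, ?_⟩
      simpa using congrArg Subtype.val hab
    · rintro ⟨a, y, hy, rfl⟩
      exact K.mul_mem a.1.2 (h hy)
  rw [hU, MeasureTheory.measure_iUnion]
  · simp only [MeasureTheory.measure_smul]
    rw [ENNReal.tsum_const, Subgroup.relIndex, ← hs.card_left, Nat.card_coe_set_eq]
    rw [show ENat.card s = s.encard from rfl, ← Set.Finite.cast_ncard_eq hs', ENat.toENNReal_coe]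
  · intro a b hab
    rw [Function.onFun, Set.disjoint_left]
    rintro _ ⟨y, hy, rfl⟩ ⟨z, hz, hzy⟩
    apply hab
    have h1 : ((b.1 : K) : G)⁻¹ * a.1 ∈ J := by
      have : ((b.1 : K) : G)⁻¹ * a.1 = z * y⁻¹ := by
        simp only [smul_eq_mul] at hzy
        rw [inv_mul_eq_iff_eq_mul, ← mul_assoc, hzy, mul_inv_cancel_right]
      rw [this]
      exact J.mul_mem hz (J.inv_mem hy)
    have h2 : (b.1)⁻¹ * a.1 ∈ J.subgroupOf K := Subgroup.mem_subgroupOf.2 (by simpa using h1)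
    have := hs.1 (a₁ := (a, 1)) (a₂ := (b, ⟨_, h2⟩)) (by simp)
    exact congrArg Prod.fst this
  · exact fun a => (hJ.measurableSet).const_smul _

/-- Since `p > 1` the exponent is determined by the measure, so the choice inside `vol` is harmless.
-/
theorem vol_eq {K : Subgroup G} {a : ℤ} (h : μ (K : Set G) = (p : ENNReal) ^ a) :
    vol μ hp K = hp.unit ^ a := by
  have hp1 := (ProPHaar.prime (p := p) μ).one_lt
  have := Classical.epsilon_spec (p := fun a : ℤ => μ (K : Set G) = (p : ENNReal) ^ a) ⟨a, h⟩
  rw [vol]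
  congr 1
  suffices ∀ b : ℤ, (p : ENNReal) ^ a = (p : ENNReal) ^ b → b = a from this _ (h.symm.trans ‹_›)
  intro b h2
  have hp0 : (p : NNReal) ≠ 0 := by exact_mod_cast (one_pos.trans hp1).ne'
  rw [← ENNReal.coe_natCast, ← ENNReal.coe_zpow hp0, ← ENNReal.coe_zpow hp0,
    ENNReal.coe_inj] at h2
  exact (zpow_right_injective₀ (by exact_mod_cast one_pos.trans hp1)
    (by exact_mod_cast hp1.ne') h2).symm

theorem vol_eq_mul {J K : Subgroup G} (hJ : IsOpen (J : Set G)) (hK : IsOpenProP p K)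
    (h : J ≤ K) : (vol μ hp K : R) = J.relIndex K * (vol μ hp J : R) := by
  have hp1 := ProPHaar.prime (p := p) μ
  obtain ⟨a, ha⟩ := ProPHaar.measure_eq (μ := μ) K hK
  obtain ⟨b, hb⟩ := ProPHaar.measure_eq (μ := μ) J (hK.mono hp1 hJ h)
  obtain ⟨k, hk⟩ := hK.2.2 J hJ h
  have h1 : μ (K : Set G) = (p : ENNReal) ^ ((k : ℤ) + b) := by
    rw [measure_eq_relIndex_mul μ hJ hK h, hb, hk,
      ENNReal.zpow_add (by exact_mod_cast hp1.ne_zero) (by simp)]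
    simp
  rw [vol_eq μ hp h1, vol_eq μ hp hb, hk, zpow_add]
  simp

/-- `R` need not be commutative, but volumes are integral powers of `p` and hence central. -/
theorem vol_commute (K : Subgroup G) (r : R) : Commute (vol μ hp K : R) r := by
  apply Commute.symm
  apply Commute.units_zpow_right
  exact (Nat.cast_commute p r).symm

end Haar

/-! ### The integral of locally constant, compactly supported functions -/

section Integral

variable {G : Type*} [Group G] [TopologicalSpace G] [IsTopologicalGroup G] [MeasurableSpace G]
  [BorelSpace G] {p : ℕ} (μ : MeasureTheory.Measure G) [ProPHaar p μ] {R : Type*} [Ring R]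
  (hp : IsUnit (p : R)) {V W : Type*} [AddCommGroup V] [Module R V] [AddCommGroup W] [Module R W]

/-- `φ` is invariant under right translation by `L`. -/
def RightInv {X : Type*} (L : Subgroup G) (φ : G → X) : Prop :=
  ∀ x, ∀ l ∈ L, φ (x * l) = φ x

theorem RightInv.mono {X : Type*} {J L : Subgroup G} {φ : G → X} (h : RightInv L φ) (hJ : J ≤ L) :
    RightInv J φ := fun x l hl => h x l (hJ hl)

theorem RightInv.out {X : Type*} {L : Subgroup G} {φ : G → X} (h : RightInv L φ) (x : G) :
    φ (x : G ⧸ L).out = φ x := by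
  obtain ⟨l, hl⟩ := QuotientGroup.mk_out_eq_mul L x
  rw [hl, h x l l.2]

theorem finite_support_out {L : Subgroup G} (hL : IsOpen (L : Set G)) {φ : G → V}
    (hc : HasCompactSupport φ) : (Function.support fun q : G ⧸ L => φ q.out).Finite := by
  have : DiscreteTopology (G ⧸ L) := QuotientGroup.discreteTopology hL
  have h1 : ((QuotientGroup.mk : G → G ⧸ L) '' tsupport φ).Finite :=
    (hc.isCompact.image QuotientGroup.continuous_mk).finite_of_discrete
  refine h1.subset fun q hq => ⟨q.out, subset_tsupport _ hq, by simp⟩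

/-- Each coset of `L` splits into `J.relIndex L` cosets of `J`, and `φ` is constant on it. -/
theorem finsum_refine {J L : Subgroup G} (hJ : IsOpen (J : Set G)) (hL : IsOpenProP p L)
    (h : J ≤ L) (hpp : p.Prime) {φ : G → V} (hφ : RightInv L φ) (hc : HasCompactSupport φ) :
    ∑ᶠ q : G ⧸ J, φ q.out = J.relIndex L • ∑ᶠ q : G ⧸ L, φ q.out := by
  have hfin : (J.subgroupOf L).FiniteIndex := ⟨hL.relIndex_ne_zero hpp hJ h⟩
  have hF := finite_support_out hL.1 hc
  have hfst : ∀ q : G ⧸ J, φ q.out = φ (Subgroup.quotientEquivProdOfLE h q).1.out := by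
    intro q
    induction q using QuotientGroup.induction_on with
    | H x =>
      rw [(hφ.mono h).out]
      exact (hφ.out x).symm
  rw [finsum_congr hfst, finsum_comp_equiv (Subgroup.quotientEquivProdOfLE h)
    (f := fun ab => φ ab.1.out), finsum_curry]
  · have : ∀ a : G ⧸ L, ∑ᶠ _b : L ⧸ J.subgroupOf L, φ a.out = J.relIndex L • φ a.out := by
      intro a
      have := Fintype.ofFinite (L ⧸ J.subgroupOf L)
      rw [finsum_eq_sum_of_fintype, Finset.sum_const, Finset.card_univ, ← Nat.card_eq_fintype_card]
      rfl
    rw [finsum_congr this, smul_finsum' _ hF]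
  · refine (hF.prod (Set.finite_univ (α := L ⧸ J.subgroupOf L))).subset ?_
    rintro ⟨a, b⟩ hab
    exact ⟨hab, trivial⟩

theorem haarSum_refine {J L : Subgroup G} (hJ : IsOpen (J : Set G)) (hL : IsOpenProP p L)
    (h : J ≤ L) {φ : G → V} (hφ : RightInv L φ) (hc : HasCompactSupport φ) :
    (vol μ hp L : R) • ∑ᶠ q : G ⧸ L, φ q.out = (vol μ hp J : R) • ∑ᶠ q : G ⧸ J, φ q.out := by
  rw [finsum_refine hJ hL h (ProPHaar.prime μ) hφ hc, vol_eq_mul μ hp hJ hL h,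
    (Nat.cast_commute _ _).eq, mul_smul, Nat.cast_smul_eq_nsmul]

/-- The sum does not depend on the subgroup: two choices are compared through their intersection,
where refining the cosets is offset by the smaller volume. -/
theorem haarInt_eq {L : Subgroup G} (hL : IsOpenProP p L) {φ : G → V} (hφ : RightInv L φ)
    (hc : HasCompactSupport φ) :
    haarInt μ hp φ = (vol μ hp L : R) • ∑ᶠ q : G ⧸ L, φ q.out := by
  have h : ∃ L : Subgroup G, IsOpenProP p L ∧ ∀ x, ∀ l ∈ L, φ (x * l) = φ x := ⟨L, hL, hφ⟩
  rw [haarInt, dif_pos h]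
  have hJ : IsOpen ((h.choose ⊓ L : Subgroup G) : Set G) := h.choose_spec.1.1.inter hL.1
  rw [haarSum_refine μ hp hJ h.choose_spec.1 inf_le_left h.choose_spec.2 hc,
    haarSum_refine μ hp hJ hL inf_le_right hφ hc]

theorem haarInt_eq_sum {L : Subgroup G} (hL : IsOpenProP p L) {φ : G → V} (hφ : RightInv L φ)
    (S : Finset (G ⧸ L)) (hS : ∀ x, φ x ≠ 0 → (x : G ⧸ L) ∈ S) :
    haarInt μ hp φ = (vol μ hp L : R) • ∑ q ∈ S, φ q.out := by
  rw [haarInt_eq μ hp hL hφ, finsum_eq_sum_of_support_subset]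
  · intro q hq
    simpa using hS _ hq
  · have : IsCompact (⋃ q ∈ S, (q.out • (L : Set G))) := by
      apply S.isCompact_biUnion
      exact fun q _ => hL.2.1.smul _
    refine HasCompactSupport.intro this fun x hx => ?_
    by_contra h
    apply hx
    simp only [Set.mem_iUnion]
    refine ⟨_, hS x h, ?_⟩
    obtain ⟨l, hl⟩ := QuotientGroup.mk_out_eq_mul L x
    refine ⟨l⁻¹, L.inv_mem l.2, ?_⟩
    simp [hl]

theorem exists_finset_support {L : Subgroup G} (hL : IsOpen (L : Set G)) {C : Set G}
    (hC : IsCompact C) : ∃ S : Finset (G ⧸ L), ∀ x ∈ C, (x : G ⧸ L) ∈ S := by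
  have : DiscreteTopology (G ⧸ L) := QuotientGroup.discreteTopology hL
  have h1 : ((QuotientGroup.mk : G → G ⧸ L) '' C).Finite :=
    (hC.image QuotientGroup.continuous_mk).finite_of_discrete
  exact ⟨h1.toFinset, fun x hx => by simpa using ⟨x, hx, rfl⟩⟩

theorem haarInt_map (A : V →ₗ[R] W) {L : Subgroup G} (hL : IsOpenProP p L) {φ : G → V}
    (hφ : RightInv L φ) (hc : HasCompactSupport φ) :
    A (haarInt μ hp φ) = haarInt μ hp fun x => A (φ x) := by
  rw [haarInt_eq μ hp hL hφ hc, haarInt_eq μ hp hL (φ := fun x => A (φ x))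
    (fun x l hl => by simp only [hφ x l hl]) (hc.comp_left (map_zero A)), map_smul]
  congr 1
  exact A.toAddMonoidHom.map_finsum (finite_support_out hL.1 hc)

theorem haarInt_smul (r : R) {L : Subgroup G} (hL : IsOpenProP p L) {φ : G → V}
    (hφ : RightInv L φ) (hc : HasCompactSupport φ) :
    r • haarInt μ hp φ = haarInt μ hp fun x => r • φ x := by
  rw [haarInt_eq μ hp hL hφ hc, haarInt_eq μ hp hL (φ := fun x => r • φ x)
    (fun x l hl => by simp only [hφ x l hl]) (hc.comp_left (smul_zero r)), ← mul_smul,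
    ← (vol_commute μ hp L r).eq, mul_smul]
  congr 1
  exact smul_finsum' r (finite_support_out hL.1 hc)

theorem haarInt_add {L : Subgroup G} (hL : IsOpenProP p L) {φ ψ : G → V}
    (hφ : RightInv L φ) (hc : HasCompactSupport φ) (hψ : RightInv L ψ)
    (hd : HasCompactSupport ψ) :
    haarInt μ hp (fun x => φ x + ψ x) = haarInt μ hp φ + haarInt μ hp ψ := by
  rw [haarInt_eq μ hp hL hφ hc, haarInt_eq μ hp hL hψ hd, haarInt_eq μ hp hL
    (φ := fun x => φ x + ψ x) (fun x l hl => by simp only [hφ x l hl, hψ x l hl]) (hc.add hd),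
    ← smul_add]
  congr 1
  exact finsum_add_distrib (finite_support_out hL.1 hc) (finite_support_out hL.1 hd)

theorem haarInt_mul_left (g : G) {L : Subgroup G} (hL : IsOpenProP p L) {φ : G → V}
    (hφ : RightInv L φ) (hc : HasCompactSupport φ) :
    haarInt μ hp (fun x => φ (g * x)) = haarInt μ hp φ := by
  have h1 : RightInv L fun x => φ (g * x) := fun x l hl => by
    simp only [← mul_assoc]; exact hφ _ l hl
  rw [haarInt_eq μ hp hL hφ hc,
    haarInt_eq μ hp hL h1 (hc.comp_homeomorph (Homeomorph.mulLeft g)),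
    ← finsum_comp_equiv (MulAction.toPerm g : Equiv.Perm (G ⧸ L)) (f := fun q => φ q.out)]
  congr 1
  refine finsum_congr fun q => ?_
  induction q using QuotientGroup.induction_on with
  | H x => rw [h1.out x]; exact (hφ.out (g * x)).symm

/-- The factor by which right translation changes the measure of a compact open pro-`p`
subgroup. -/
def modFactor (K : Subgroup G) (g : G) : Rˣ := vol μ hp (conjSub g K) * (vol μ hp K)⁻¹

/-- The factor is the same for all compact open pro-`p` subgroups: any two are compared with their
intersection, and conjugation preserves relative indices. -/
theorem modFactor_mul_vol {K L : Subgroup G} (hK : IsOpenProP p K) (hL : IsOpenProP p L) (g : G) :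
    (modFactor μ hp K g : R) * vol μ hp L = vol μ hp (conjSub g L) := by
  have aux : ∀ {J K : Subgroup G}, IsOpenProP p J → IsOpenProP p K → J ≤ K →
      (vol μ hp (conjSub g K) : R) * (vol μ hp J : R) =
        (vol μ hp (conjSub g J) : R) * (vol μ hp K : R) := by
    intro J K hJ hK h
    rw [vol_eq_mul μ hp hJ.1 hK h, vol_eq_mul μ hp (hJ.conjSub g).1 (hK.conjSub g)
      (conjSub_mono h), relIndex_conjSub, (Nat.cast_commute _ _).eq, mul_assoc]
  have hJ : IsOpenProP p (K ⊓ L) := hK.mono (ProPHaar.prime μ) (hK.1.inter hL.1) inf_le_left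
  have h1 := aux hJ hK inf_le_left
  have h2 := aux hJ hL inf_le_right
  have c := fun (A : Subgroup G) (r : R) => (vol_commute μ hp A r).eq
  have h1' : (modFactor μ hp K g : R) * (vol μ hp (K ⊓ L) : R) = vol μ hp (conjSub g (K ⊓ L)) := by
    rw [modFactor, Units.val_mul, mul_assoc, ← c, ← mul_assoc, h1, mul_assoc, Units.mul_inv,
      mul_one]
  rw [← (vol μ hp (K ⊓ L)).mul_left_inj, h2, ← h1', mul_assoc, mul_assoc, c L]

theorem haarInt_mul_right {K : Subgroup G} (hK : IsOpenProP p K) (g : G) {L : Subgroup G}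
    (hL : IsOpenProP p L) {φ : G → V} (hφ : RightInv L φ) (hc : HasCompactSupport φ) :
    haarInt μ hp (fun x => φ (x * g)) = (modFactor μ hp K g : R) • haarInt μ hp φ := by
  have h1 : RightInv (conjSub g L) fun x => φ (x * g) := fun x l hl => by
    have : x * l * g = x * g * (g⁻¹ * l * g) := by group
    simp only [this]
    exact hφ _ _ (mem_conjSub.1 hl)
  rw [haarInt_eq μ hp hL hφ hc,
    haarInt_eq μ hp (hL.conjSub g) h1 (hc.comp_homeomorph (Homeomorph.mulRight g)),
    ← mul_smul, modFactor_mul_vol μ hp hK hL]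
  congr 1
  let E : G ⧸ conjSub g L ≃ G ⧸ L := Quotient.congr (Equiv.mulRight g) fun a b => by
    rw [QuotientGroup.leftRel_apply, QuotientGroup.leftRel_apply, mem_conjSub]
    simp [mul_assoc]
  rw [← finsum_comp_equiv E (f := fun q => φ q.out)]
  refine finsum_congr fun q => ?_
  induction q using QuotientGroup.induction_on with
  | H x => rw [h1.out x]; exact (hφ.out (x * g)).symm

/-- A common invariance group `J` and the compact sets `C`, `D` turn both integrals into finite
sums, so this is an exchange of finite sums. -/
theorem haarInt_comm {J : Subgroup G} (hJ : IsOpenProP p J) {F : G → G → V} {C D : Set G}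
    (hC : IsCompact C) (hD : IsCompact D) (h1 : ∀ x y, ∀ j ∈ J, F (x * j) y = F x y)
    (h2 : ∀ x y, ∀ j ∈ J, F x (y * j) = F x y) (h0 : ∀ x y, F x y ≠ 0 → x ∈ C ∧ y ∈ D) :
    haarInt μ hp (fun x => haarInt μ hp fun y => F x y) =
      haarInt μ hp fun y => haarInt μ hp fun x => F x y := by
  obtain ⟨S, hS⟩ := exists_finset_support hJ.1 hC
  obtain ⟨T, hT⟩ := exists_finset_support hJ.1 hD
  have e1 : ∀ x, haarInt μ hp (fun y => F x y) = (vol μ hp J : R) • ∑ q ∈ T, F x q.out :=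
    fun x => haarInt_eq_sum μ hp hJ (h2 x) T fun y hy => hT y (h0 x y hy).2
  have e2 : ∀ y, haarInt μ hp (fun x => F x y) = (vol μ hp J : R) • ∑ q ∈ S, F q.out y :=
    fun y => haarInt_eq_sum μ hp hJ (fun x j hj => h1 x y j hj) S fun x hx => hS x (h0 x y hx).1
  simp only [e1, e2]
  rw [haarInt_eq_sum μ hp hJ _ S, haarInt_eq_sum μ hp hJ _ T, ← Finset.smul_sum,
    ← Finset.smul_sum, Finset.sum_comm]
  · intro y hy
    by_contra hyT
    apply hy
    rw [Finset.sum_eq_zero, smul_zero]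
    intro q _
    by_contra h
    exact hyT (hT y (h0 _ _ h).2)
  · intro y j hj
    simp only [fun x => h2 x y j hj]
  · intro x hx
    by_contra hxS
    apply hx
    rw [Finset.sum_eq_zero, smul_zero]
    intro q _
    by_contra h
    exact hxS (hS x (h0 _ _ h).1)
  · intro x j hj
    simp only [fun y => h1 x y j hj]

end Integral

/-! ### Smooth representations and modules over the Hecke algebra -/

section HeckeModule

variable {G : Type*} [Group G] [TopologicalSpace G] [IsTopologicalGroup G] [MeasurableSpace G]
  [BorelSpace G] {p : ℕ} (μ : MeasureTheory.Measure G) [ProPHaar p μ] {R : Type*} [Ring R]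
  (hp : IsUnit (p : R)) {V W : Type*} [AddCommGroup V] [Module R V] [AddCommGroup W] [Module R W]
  {π : G →* Module.End R V} {σ : G →* Module.End R W}

theorem Hecke.exists_nhds_rightInv (f : Hecke G R) :
    ∃ s ∈ 𝓝 (1 : G), ∀ x, ∀ l ∈ s, f.1 (x * l) = f.1 x := by
  have key : ∀ᶠ l in 𝓝 (1 : G), ∀ x ∈ tsupport f.1, f.1 (x * l) = f.1 x := by
    apply IsCompact.eventually_forall_of_forall_eventually f.2.2
    intro x _
    have h1 : IsLocallyConstant fun z : G × G => f.1 (z.2 * z.1) :=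
      f.2.1.comp_continuous (by fun_prop)
    have h2 : IsLocallyConstant fun z : G × G => f.1 z.2 :=
      f.2.1.comp_continuous (by fun_prop)
    filter_upwards [(IsLocallyConstant.iff_eventually_eq _).1 h1 (1, x),
      (IsLocallyConstant.iff_eventually_eq _).1 h2 (1, x)] with z hz1 hz2
    rw [hz1, hz2, mul_one]
  have key' : ∀ᶠ l in 𝓝 (1 : G), ∀ x ∈ tsupport f.1, f.1 (x * l⁻¹) = f.1 x := by
    have : Filter.Tendsto (fun l : G => l⁻¹) (𝓝 1) (𝓝 1) := by
      simpa using (continuous_inv (G := G)).tendsto 1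
    exact this.eventually key
  -- The condition on `l⁻¹` handles `x` outside the support: if `x * l` lies in the support, going
  -- back by `l⁻¹` shows that `f` vanishes there.
  refine ⟨_, Filter.inter_mem key key', fun x l hl => ?_⟩
  by_cases hx : x ∈ tsupport f.1
  · exact hl.1 x hx
  · rw [image_eq_zero_of_notMem_tsupport hx]
    by_cases hxl : x * l ∈ tsupport f.1
    · have := hl.2 _ hxl
      rw [mul_inv_cancel_right, image_eq_zero_of_notMem_tsupport hx] at this
      exact this.symm
    · exact image_eq_zero_of_notMem_tsupport hxl

include p μ in
theorem Hecke.exists_rightInv (f : Hecke G R) :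
    ∃ L : Subgroup G, IsOpenProP p L ∧ RightInv L f.1 := by
  obtain ⟨s, hs, h⟩ := Hecke.exists_nhds_rightInv f
  obtain ⟨L, hL, hLs⟩ := ProPHaar.small (p := p) (μ := μ) s hs
  exact ⟨L, hL, fun x l hl => h x l (hLs hl)⟩

/-- The involution `f ↦ (x ↦ f x⁻¹)` of the space of locally constant, compactly supported
functions. -/
def flip (f : Hecke G R) : Hecke G R :=
  ⟨fun x => f.1 x⁻¹, f.2.1.comp_continuous continuous_inv, f.2.2.comp_homeomorph (Homeomorph.inv G)⟩

theorem flip_flip (f : Hecke G R) : flip (flip f) = f := by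
  ext x
  simp [flip]

include p μ in
theorem Hecke.exists_leftInv (f : Hecke G R) :
    ∃ L : Subgroup G, IsOpenProP p L ∧ ∀ x, ∀ l ∈ L, f.1 (l * x) = f.1 x := by
  obtain ⟨L, hL, h⟩ := Hecke.exists_rightInv (p := p) μ (flip f)
  refine ⟨L, hL, fun x l hl => ?_⟩
  simpa [flip] using h x⁻¹ l⁻¹ (L.inv_mem hl)

/-- The right regular representation, `(g f)(x) = f(x g)`. -/
def rightReg (G : Type*) [Group G] [TopologicalSpace G] [IsTopologicalGroup G] (R : Type*)
    [Ring R] : G →* Module.End R (Hecke G R) where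
  toFun g :=
    { toFun := fun f => ⟨fun x => f.1 (x * g),
        f.2.1.comp_continuous (continuous_mul_const g),
        f.2.2.comp_homeomorph (Homeomorph.mulRight g)⟩
      map_add' := fun _ _ => rfl
      map_smul' := fun _ _ => rfl }
  map_one' := by
    ext f x
    simp
  map_mul' g h := by
    ext f x
    simp [mul_assoc]

include p μ in
theorem isSmooth_leftReg : IsSmooth (leftReg G R) := by
  intro f
  obtain ⟨L, hL, h⟩ := Hecke.exists_leftInv μ f (p := p)
  refine ⟨L, hL.1, fun l hl => ?_⟩
  ext x
  exact h x l⁻¹ (L.inv_mem hl)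

include p μ in
theorem isSmooth_rightReg : IsSmooth (rightReg G R) := by
  intro f
  obtain ⟨L, hL, h⟩ := Hecke.exists_rightInv μ f (p := p)
  refine ⟨L, hL.1, fun l hl => ?_⟩
  ext x
  exact h x l hl

include p μ in
theorem IsSmooth.exists_proP (hπ : IsSmooth π) (v : V) :
    ∃ L : Subgroup G, IsOpenProP p L ∧ ∀ l ∈ L, π l v = v := by
  obtain ⟨s, hs, h⟩ := hπ v
  obtain ⟨L, hL, hLs⟩ := exists_proP_le (p := p) μ hs
  exact ⟨L, hL, fun l hl => h l (hLs hl)⟩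

theorem rep_mul (π : G →* Module.End R V) (g h : G) (v : V) : π (g * h) v = π g (π h v) := by
  rw [map_mul]
  rfl

theorem rep_one (π : G →* Module.End R V) (v : V) : π 1 v = v := by
  rw [map_one]
  rfl

include p μ in
theorem exists_rightInv_smul (hπ : IsSmooth π) (f : Hecke G R) (v : V) :
    ∃ L : Subgroup G, IsOpenProP p L ∧ RightInv L fun x => f.1 x • π x v := by
  obtain ⟨L, hL, hv⟩ := hπ.exists_proP μ (p := p) v
  obtain ⟨J, hJ, hf⟩ := Hecke.exists_rightInv (p := p) μ f
  refine ⟨L ⊓ J, hL.mono (ProPHaar.prime μ) (hL.1.inter hJ.1) inf_le_left, fun x l hl => ?_⟩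
  simp only [hf x l hl.2, rep_mul, hv l hl.1]

theorem hasCompactSupport_smul (f : Hecke G R) (ψ : G → V) :
    HasCompactSupport fun x => f.1 x • ψ x :=
  f.2.2.smul_right (f' := ψ)

theorem heckeAct_add (hπ : IsSmooth π) (f : Hecke G R) (v w : V) :
    heckeAct μ hp π f (v + w) = heckeAct μ hp π f v + heckeAct μ hp π f w := by
  obtain ⟨L, hL, h1⟩ := exists_rightInv_smul (p := p) μ hπ f v
  obtain ⟨J, hJ, h2⟩ := exists_rightInv_smul (p := p) μ hπ f w
  have hLJ := hL.mono (ProPHaar.prime μ) (hL.1.inter hJ.1) (inf_le_left : L ⊓ J ≤ L)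
  rw [heckeAct, heckeAct, heckeAct, ← haarInt_add μ hp hLJ (h1.mono inf_le_left)
    (hasCompactSupport_smul f _) (h2.mono inf_le_right) (hasCompactSupport_smul f _)]
  simp only [map_add, smul_add]

theorem heckeAct_map (hπ : IsSmooth π) (A : V →ₗ[R] W) (hA : ∀ g v, A (π g v) = σ g (A v))
    (f : Hecke G R) (v : V) : A (heckeAct μ hp π f v) = heckeAct μ hp σ f (A v) := by
  obtain ⟨L, hL, h1⟩ := exists_rightInv_smul (p := p) μ hπ f v
  rw [heckeAct, haarInt_map μ hp A hL h1 (hasCompactSupport_smul f _), heckeAct]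
  simp only [map_smul, hA]

/-- Over a noncommutative `R` the operator of `f` is linear only for scalars commuting with the
values of `f`. This applies to `e_K`, whose values are central. -/
theorem heckeAct_smul (hπ : IsSmooth π) (f : Hecke G R) (r : R) (hr : ∀ x, Commute r (f.1 x))
    (v : V) : heckeAct μ hp π f (r • v) = r • heckeAct μ hp π f v := by
  obtain ⟨L, hL, h1⟩ := exists_rightInv_smul (p := p) μ hπ f v
  rw [heckeAct, heckeAct, haarInt_smul μ hp r hL h1 (hasCompactSupport_smul f _)]
  congr 1
  funext x
  rw [map_smul, smul_smul, smul_smul, (hr x).eq]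

theorem heckeAct_leftReg (hπ : IsSmooth π) (g : G) (f : Hecke G R) (v : V) :
    heckeAct μ hp π (leftReg G R g f) v = π g (heckeAct μ hp π f v) := by
  obtain ⟨L, hL, h1⟩ := exists_rightInv_smul (p := p) μ hπ f v
  obtain ⟨J, hJ, h2⟩ := exists_rightInv_smul (p := p) μ hπ (leftReg G R g f) v
  rw [heckeAct, heckeAct, haarInt_map μ hp (π g) hL h1 (hasCompactSupport_smul f _),
    ← haarInt_mul_left μ hp g hJ h2 (hasCompactSupport_smul _ _)]
  congr 1
  funext x
  rw [map_smul, ← rep_mul]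
  simp [leftReg]

/-- Evaluation at a point is linear and passes through the integral. Facts about smooth
representations thereby become facts about convolution. -/
theorem conv_eq_heckeAct (f h : Hecke G R) : conv μ hp f h = heckeAct μ hp (leftReg G R) f h := by
  ext g
  obtain ⟨L, hL, h1⟩ := exists_rightInv_smul (p := p) μ (isSmooth_leftReg (p := p) μ) f h
  let A : Hecke G R →ₗ[R] R := (LinearMap.proj g).comp (Hecke G R).subtype
  exact (haarInt_map μ hp A hL h1 (hasCompactSupport_smul f _)).symm

/-- Left invariance of the integral replaces `y` by `x⁻¹ * y`, and `haarInt_comm` exchanges the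
integrals. Left invariance of `h` under `J` is what makes `x ↦ h (x⁻¹ * y)` right invariant. -/
theorem heckeAct_heckeAct (hπ : IsSmooth π) (f h : Hecke G R) (v : V) :
    heckeAct μ hp π f (heckeAct μ hp π h v) = heckeAct μ hp π (conv μ hp f h) v := by
  obtain ⟨L₁, hL₁, h1⟩ := hπ.exists_proP (p := p) μ v
  obtain ⟨L₂, hL₂, h2⟩ := Hecke.exists_rightInv (p := p) μ f
  obtain ⟨L₃, hL₃, h3⟩ := Hecke.exists_rightInv (p := p) μ h
  obtain ⟨L₄, hL₄, h4⟩ := Hecke.exists_leftInv (p := p) μ h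
  set J := L₁ ⊓ (L₂ ⊓ (L₃ ⊓ L₄))
  have hJ : IsOpenProP p J :=
    hL₁.mono (ProPHaar.prime μ) (hL₁.1.inter (hL₂.1.inter (hL₃.1.inter hL₄.1))) inf_le_left
  have hhv : RightInv J fun y => h.1 y • π y v := fun x l hl => by
    simp only [h3 x l hl.2.2.1, rep_mul, h1 l hl.1]
  have e1 : heckeAct μ hp π f (heckeAct μ hp π h v) =
      haarInt μ hp fun x => haarInt μ hp fun y => f.1 x • h.1 (x⁻¹ * y) • π y v := by
    rw [heckeAct]
    congr 1
    funext x
    have h5 : RightInv J fun y => f.1 x • h.1 (x⁻¹ * y) • π y v := fun y l hl => by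
      simp only [← mul_assoc, h3 _ l hl.2.2.1, rep_mul, h1 l hl.1]
    have h6 : HasCompactSupport fun y => f.1 x • h.1 (x⁻¹ * y) • π y v :=
      (hasCompactSupport_smul (leftReg G R x h) fun y => π y v).comp_left
        (g := fun w => f.1 x • w) (smul_zero _)
    rw [heckeAct, haarInt_map μ hp (π x) hJ hhv (hasCompactSupport_smul h _),
      haarInt_smul μ hp (f.1 x) hJ (φ := fun y => π x (h.1 y • π y v))
        (fun y l hl => by simp only [hhv y l hl])
        ((hasCompactSupport_smul h _).comp_left (map_zero _)),
      ← haarInt_mul_left μ hp x hJ h5 h6]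
    simp
  have e2 : heckeAct μ hp π (conv μ hp f h) v =
      haarInt μ hp fun y => haarInt μ hp fun x => f.1 x • h.1 (x⁻¹ * y) • π y v := by
    rw [heckeAct]
    congr 1
    funext y
    have h5 : RightInv J fun x => f.1 x * h.1 (x⁻¹ * y) := fun x l hl => by
      have : (x * l)⁻¹ * y = l⁻¹ * (x⁻¹ * y) := by group
      simp only [this, h2 x l hl.2.1, h4 _ _ (J.inv_mem hl).2.2.2]
    have := haarInt_map μ hp (LinearMap.toSpanSingleton R V (π y v)) hJ h5 f.2.2.mul_right
    simp only [LinearMap.toSpanSingleton_apply, mul_smul] at this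
    exact this
  rw [e1, e2]
  refine haarInt_comm μ hp hJ f.2.2 (f.2.2.mul h.2.2) ?_ ?_ ?_
  · intro x y l hl
    have : (x * l)⁻¹ * y = l⁻¹ * (x⁻¹ * y) := by group
    simp only [this, h2 x l hl.2.1, h4 _ _ (J.inv_mem hl).2.2.2]
  · intro x y l hl
    simp only [← mul_assoc, h3 _ l hl.2.2.1, rep_mul, h1 l hl.1]
  · intro x y hxy
    have hx : x ∈ tsupport f.1 := by
      by_contra hx
      exact hxy (by rw [image_eq_zero_of_notMem_tsupport hx, zero_smul])
    refine ⟨hx, x, hx, x⁻¹ * y, ?_, by simp⟩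
    by_contra hy
    exact hxy (by rw [image_eq_zero_of_notMem_tsupport hy, zero_smul, smul_zero])

theorem conv_assoc (f g h : Hecke G R) :
    conv μ hp (conv μ hp f g) h = conv μ hp f (conv μ hp g h) := by
  simp only [conv_eq_heckeAct μ hp _ h, conv_eq_heckeAct μ hp f (heckeAct _ _ _ _ _)]
  exact (heckeAct_heckeAct μ hp (isSmooth_leftReg μ (p := p)) f g h).symm

theorem convPow_add (f : Hecke G R) (a b : ℕ) :
    conv μ hp (convPow μ hp f a) (convPow μ hp f b) = convPow μ hp f (a + b + 1) := by
  induction a with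
  | zero => rw [Nat.zero_add]; rfl
  | succ a ih =>
    rw [convPow, conv_assoc, ih, show a + 1 + b + 1 = (a + b + 1) + 1 by ring]
    rfl

theorem convPow_succ' (f : Hecke G R) (a : ℕ) :
    convPow μ hp f (a + 1) = conv μ hp (convPow μ hp f a) f :=
  (convPow_add μ hp f a 0).symm

end HeckeModule

section Idempotents

variable {G : Type*} [Group G] [TopologicalSpace G] [IsTopologicalGroup G] [MeasurableSpace G]
  [BorelSpace G] {p : ℕ} (μ : MeasureTheory.Measure G) [ProPHaar p μ] {R : Type*} [Ring R]
  (hp : IsUnit (p : R)) {V W : Type*} [AddCommGroup V] [Module R V] [AddCommGroup W] [Module R W]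
  {π : G →* Module.End R V}

/-! ### The idempotents `e_K` -/

theorem idem_apply_of_mem {K : Subgroup G} (hK : IsOpenProP p K) {x : G} (hx : x ∈ K) :
    (idem μ hp K hK).1 x = ((vol μ hp K)⁻¹ : Rˣ) :=
  Set.indicator_of_mem (s := (K : Set G)) hx fun _ => (((vol μ hp K)⁻¹ : Rˣ) : R)

theorem idem_apply_of_notMem {K : Subgroup G} (hK : IsOpenProP p K) {x : G} (hx : x ∉ K) :
    (idem μ hp K hK).1 x = 0 :=
  Set.indicator_of_notMem (s := (K : Set G)) hx fun _ => (((vol μ hp K)⁻¹ : Rˣ) : R)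

theorem idem_apply_congr {K : Subgroup G} (hK : IsOpenProP p K) {x y : G} (h : x ∈ K ↔ y ∈ K) :
    (idem μ hp K hK).1 x = (idem μ hp K hK).1 y := by
  by_cases hx : x ∈ K
  · rw [idem_apply_of_mem μ hp hK hx, idem_apply_of_mem μ hp hK (h.1 hx)]
  · rw [idem_apply_of_notMem μ hp hK hx, idem_apply_of_notMem μ hp hK (mt h.2 hx)]

theorem idem_commute {K : Subgroup G} (hK : IsOpenProP p K) (r : R) (x : G) :
    Commute r ((idem μ hp K hK).1 x) := by
  by_cases hx : x ∈ K
  · rw [idem_apply_of_mem μ hp hK hx]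
    exact Commute.units_inv_right (vol_commute μ hp K r).symm
  · rw [idem_apply_of_notMem μ hp hK hx]
    exact Commute.zero_right r

theorem leftReg_idem {K : Subgroup G} (hK : IsOpenProP p K) {k : G} (hk : k ∈ K) :
    leftReg G R k (idem μ hp K hK) = idem μ hp K hK := by
  ext x
  exact idem_apply_congr μ hp hK (K.mul_mem_cancel_left (K.inv_mem hk))

/-- A linear map that is constant on the `K`-orbit of `x` takes the same value at `e_K x`. -/
theorem map_idem_eq (hπ : IsSmooth π) {K : Subgroup G} (hK : IsOpenProP p K) (A : V →ₗ[R] W)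
    {x : V} {y : W} (h : ∀ k ∈ K, A (π k x) = y) :
    A (heckeAct μ hp π (idem μ hp K hK) x) = y := by
  obtain ⟨L, hL, h1⟩ := exists_rightInv_smul (p := p) μ hπ (idem μ hp K hK) x
  rw [heckeAct, haarInt_map μ hp A hL h1 (hasCompactSupport_smul _ _)]
  have h2 : (fun z => A ((idem μ hp K hK).1 z • π z x)) = fun z => (idem μ hp K hK).1 z • y := by
    funext z
    by_cases hz : z ∈ K
    · rw [map_smul, h z hz]
    · rw [idem_apply_of_notMem μ hp hK hz, zero_smul, zero_smul, map_zero]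
  have h3 : RightInv K fun z => (idem μ hp K hK).1 z • y := fun z k hk => by
    simp only [idem_apply_congr μ hp hK (K.mul_mem_cancel_right hk : z * k ∈ K ↔ z ∈ K)]
  rw [h2, haarInt_eq_sum μ hp hK h3 {((1 : G) : G ⧸ K)}, Finset.sum_singleton, h3.out 1,
    idem_apply_of_mem μ hp hK K.one_mem, smul_smul, Units.mul_inv, one_smul]
  intro z hz
  rw [Finset.mem_singleton, eq_comm, QuotientGroup.eq]
  by_contra hzK
  refine hz ?_
  rw [idem_apply_of_notMem μ hp hK (by simpa using hzK), zero_smul]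

theorem rep_idem (hπ : IsSmooth π) {K : Subgroup G} (hK : IsOpenProP p K) {k : G} (hk : k ∈ K)
    (x : V) : π k (heckeAct μ hp π (idem μ hp K hK) x) = heckeAct μ hp π (idem μ hp K hK) x := by
  rw [← heckeAct_leftReg μ hp hπ, leftReg_idem μ hp hK hk]

/-- Right translation by `k ∈ K` preserves the integral because `k` normalises `K`, so that its
modular factor is `1`. -/
theorem idem_rep (hπ : IsSmooth π) {K : Subgroup G} (hK : IsOpenProP p K) {k : G} (hk : k ∈ K)
    (x : V) : heckeAct μ hp π (idem μ hp K hK) (π k x) = heckeAct μ hp π (idem μ hp K hK) x := by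
  obtain ⟨L, hL, h1⟩ := exists_rightInv_smul (p := p) μ hπ (idem μ hp K hK) x
  have h2 := haarInt_mul_right μ hp hK k hL h1 (hasCompactSupport_smul _ _)
  have hc : conjSub k K = K := by
    ext y
    rw [mem_conjSub, K.mul_mem_cancel_right hk, K.mul_mem_cancel_left (K.inv_mem hk)]
  rw [modFactor, hc, mul_inv_cancel, Units.val_one, one_smul] at h2
  rw [heckeAct, heckeAct, ← h2]
  congr 1
  funext z
  rw [rep_mul, idem_apply_congr μ hp hK (K.mul_mem_cancel_right hk : z * k ∈ K ↔ z ∈ K)]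

theorem idem_eq_self (hπ : IsSmooth π) {K : Subgroup G} (hK : IsOpenProP p K) {x : V}
    (h : ∀ k ∈ K, π k x = x) : heckeAct μ hp π (idem μ hp K hK) x = x :=
  map_idem_eq μ hp hπ hK LinearMap.id h

/-- The operator `e_K` on a smooth representation. -/
def idemLin (hπ : IsSmooth π) {K : Subgroup G} (hK : IsOpenProP p K) : V →ₗ[R] V where
  toFun := heckeAct μ hp π (idem μ hp K hK)
  map_add' := heckeAct_add μ hp hπ _
  map_smul' r v := heckeAct_smul μ hp hπ _ r (idem_commute μ hp hK r) v

theorem idemLin_apply (hπ : IsSmooth π) {K : Subgroup G} (hK : IsOpenProP p K) (x : V) :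
    idemLin μ hp hπ hK x = heckeAct μ hp π (idem μ hp K hK) x := rfl

theorem conv_leftReg (g : G) (f h : Hecke G R) :
    conv μ hp (leftReg G R g f) h = leftReg G R g (conv μ hp f h) := by
  simp only [conv_eq_heckeAct]
  exact heckeAct_leftReg μ hp (isSmooth_leftReg μ (p := p)) g f h

theorem conv_idem_idem {K : Subgroup G} (hK : IsOpenProP p K) :
    conv μ hp (idem μ hp K hK) (idem μ hp K hK) = idem μ hp K hK := by
  rw [conv_eq_heckeAct]
  exact idem_eq_self μ hp (isSmooth_leftReg μ (p := p)) hK fun k hk => leftReg_idem μ hp hK hk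

theorem idem_conv_dblIdem {K : Subgroup G} (hK : IsOpenProP p K) (g : G) :
    conv μ hp (idem μ hp K hK) (dblIdem μ hp K hK g) = dblIdem μ hp K hK g := by
  rw [dblIdem, ← conv_assoc, conv_idem_idem]

theorem dblIdem_conv_idem {K : Subgroup G} (hK : IsOpenProP p K) (g : G) :
    conv μ hp (dblIdem μ hp K hK g) (idem μ hp K hK) = dblIdem μ hp K hK g := by
  rw [dblIdem, conv_assoc, conv_leftReg, conv_idem_idem]

theorem heckeAct_dblIdem (hπ : IsSmooth π) {K : Subgroup G} (hK : IsOpenProP p K) (g : G) (x : V) :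
    heckeAct μ hp π (dblIdem μ hp K hK g) x = heckeAct μ hp π (idem μ hp K hK)
      (π g (heckeAct μ hp π (idem μ hp K hK) x)) := by
  rw [dblIdem, ← heckeAct_heckeAct μ hp hπ, heckeAct_leftReg μ hp hπ]

/-! ### Stabilising powers -/

theorem conv_convPow_of_left {e u : Hecke G R} (h : conv μ hp u e = e) (m : ℕ) :
    conv μ hp u (convPow μ hp e m) = convPow μ hp e m := by
  cases m with
  | zero => exact h
  | succ m => rw [convPow, ← conv_assoc, h]

theorem convPow_conv_of_right {e u : Hecke G R} (h : conv μ hp e u = e) (m : ℕ) :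
    conv μ hp (convPow μ hp e m) u = convPow μ hp e m := by
  cases m with
  | zero => exact h
  | succ m => rw [convPow_succ', conv_assoc, h]

theorem convPow_eq_right {e x : Hecke G R} {m : ℕ}
    (h : convPow μ hp e m = conv μ hp (convPow μ hp e (m + 1)) x) (j : ℕ) :
    convPow μ hp e (m + j) = conv μ hp (convPow μ hp e (m + j + 1)) x := by
  induction j with
  | zero => exact h
  | succ j ih => rw [← add_assoc, convPow, ih, ← conv_assoc]; rfl

theorem convPow_eq_left {e x : Hecke G R} {m : ℕ}
    (h : convPow μ hp e m = conv μ hp x (convPow μ hp e (m + 1))) (j : ℕ) :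
    convPow μ hp e (m + j) = conv μ hp x (convPow μ hp e (m + j + 1)) := by
  induction j with
  | zero => exact h
  | succ j ih => rw [← add_assoc, convPow_succ', ih, conv_assoc, ← convPow_succ']

/-- Substituting the identity into itself gains one power of `e` at each step. -/
theorem exists_convPow_eq_right {e x : Hecke G R} {m : ℕ}
    (h : convPow μ hp e m = conv μ hp (convPow μ hp e (m + 1)) x) (j : ℕ) :
    ∃ y, convPow μ hp e m = conv μ hp (convPow μ hp e (m + j + 1)) y := by
  induction j with
  | zero => exact ⟨x, h⟩
  | succ j ih =>
    obtain ⟨y, hy⟩ := ih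
    refine ⟨conv μ hp x y, ?_⟩
    rw [hy, ← conv_assoc, ← convPow_eq_right μ hp h (j + 1)]
    rfl

theorem exists_convPow_eq_left {e x : Hecke G R} {m : ℕ}
    (h : convPow μ hp e m = conv μ hp x (convPow μ hp e (m + 1))) (j : ℕ) :
    ∃ y, convPow μ hp e m = conv μ hp y (convPow μ hp e (m + j + 1)) := by
  induction j with
  | zero => exact ⟨x, h⟩
  | succ j ih =>
    obtain ⟨y, hy⟩ := ih
    refine ⟨conv μ hp y x, ?_⟩
    rw [hy, conv_assoc, ← convPow_eq_left μ hp h (j + 1)]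
    rfl

theorem idealsAgree_of_eq {e x y : Hecke G R} {m : ℕ}
    (hx : convPow μ hp e m = conv μ hp (convPow μ hp e (m + 1)) x)
    (hy : convPow μ hp e m = conv μ hp y (convPow μ hp e (m + 1))) : IdealsAgree μ hp e m := by
  constructor
  · apply Set.Subset.antisymm
    · rintro _ ⟨f, rfl⟩
      exact ⟨conv μ hp x f, by simp only [hx, conv_assoc]⟩
    · rintro _ ⟨f, rfl⟩
      exact ⟨conv μ hp e f, by simp only [convPow_succ', conv_assoc]⟩
  · apply Set.Subset.antisymm
    · rintro _ ⟨f, rfl⟩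
      exact ⟨conv μ hp f y, by simp only [hy, conv_assoc]⟩
    · rintro _ ⟨f, rfl⟩
      exact ⟨conv μ hp f e, by simp only [convPow, conv_assoc]⟩

theorem exists_idealsAgree {e x y : Hecke G R} {a b : ℕ}
    (hx : convPow μ hp e a = conv μ hp (convPow μ hp e (a + 1)) x)
    (hy : convPow μ hp e b = conv μ hp y (convPow μ hp e (b + 1))) :
    ∃ m₀, ∀ m ≥ m₀, IdealsAgree μ hp e m := by
  refine ⟨max a b, fun m hm => ?_⟩
  have h1 := convPow_eq_right μ hp hx (m - a)
  have h2 := convPow_eq_left μ hp hy (m - b)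
  rw [Nat.add_sub_cancel' ((le_max_left a b).trans hm)] at h1
  rw [Nat.add_sub_cancel' ((le_max_right a b).trans hm)] at h2
  exact idealsAgree_of_eq μ hp h1 h2

/-- If the ideals generated by two consecutive powers of `e` agree, then these powers act by
stable operators. -/
theorem isStable_of_idealsAgree (hπ : IsSmooth π) {e u : Hecke G R} (hl : conv μ hp u e = e)
    (hr : conv μ hp e u = e) {m : ℕ} (h : IdealsAgree μ hp e m) :
    IsStable (heckeAct μ hp π (convPow μ hp e m)) := by
  obtain ⟨x, hx⟩ : convPow μ hp e m ∈ Set.range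
      fun f => conv μ hp (convPow μ hp e (m + 1)) f := by
    rw [← h.1]
    exact ⟨u, convPow_conv_of_right μ hp hr m⟩
  obtain ⟨y, hy⟩ : convPow μ hp e m ∈ Set.range
      fun f => conv μ hp f (convPow μ hp e (m + 1)) := by
    rw [← h.2]
    exact ⟨u, conv_convPow_of_left μ hp hl m⟩
  -- `convPow` of index `m` is the power `m + 1`, so its square has index `m + m + 1`; this is the
  -- case `j = m`.
  obtain ⟨x', hx'⟩ := exists_convPow_eq_right μ hp hx.symm m
  obtain ⟨y', hy'⟩ := exists_convPow_eq_left μ hp hy.symm m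
  rw [← convPow_add] at hx' hy'
  have h0 : heckeAct μ hp π y' 0 = 0 := by
    have := heckeAct_add μ hp hπ y' 0 0
    simpa using this
  have h0' : heckeAct μ hp π (convPow μ hp e m) 0 = 0 := by
    have := heckeAct_add μ hp hπ (convPow μ hp e m) 0 0
    simpa using this
  constructor
  · ext w
    simp only [Set.mem_ofPred_eq]
    constructor
    · intro hw
      rw [hw, h0']
    · intro hw
      rw [heckeAct_heckeAct μ hp hπ] at hw
      rw [hy', ← heckeAct_heckeAct μ hp hπ, hw, h0]
  · apply Set.Subset.antisymm
    · rintro _ ⟨w, rfl⟩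
      refine ⟨heckeAct μ hp π x' w, ?_⟩
      simp only [heckeAct_heckeAct μ hp hπ, ← conv_assoc]
      rw [← hx']
    · rintro _ ⟨w, rfl⟩
      exact ⟨_, rfl⟩

/-! ### Limits of constant systems -/

theorem exists_iterate_eq_of_limMap_surjective {X : Type*} {T : X → X}
    (h : Function.Surjective (limMap T)) (w : X) :
    ∃ (x : X) (n : ℕ), T^[n] (T x) = T^[n] w := by
  obtain ⟨x, hx⟩ := h (Quot.mk _ (0, w))
  -- `P` says that a class agrees with that of `(0, w)` after finitely many steps. As it is
  -- compatible with the generating relation, it descends to the quotient without any description of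
  -- the generated equivalence.
  let P : IndLim T → Prop := Quot.lift (fun a => ∃ n, T^[n] a.2 = T^[n + a.1] w) (by
    rintro ⟨i, a⟩ _ rfl
    simp only [eq_iff_iff]
    constructor
    · rintro ⟨n, hn⟩
      refine ⟨n, ?_⟩
      change T^[n] (T a) = T^[(n + i) + 1] w
      change T^[n] a = T^[n + i] w at hn
      rw [Function.iterate_succ_apply', ← hn, ← Function.iterate_succ_apply' T,
        Function.iterate_succ_apply]
    · rintro ⟨n, hn⟩
      refine ⟨n + 1, ?_⟩
      rw [Function.iterate_succ_apply, show n + 1 + i = n + (i + 1) by ring]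
      exact hn)
  have h1 : P (limMap T x) := by
    rw [hx]
    exact ⟨0, rfl⟩
  obtain ⟨n, hn⟩ := h1
  exact ⟨x.1 1, n, by rw [x.2 0]; exact hn⟩

theorem iterate_conv_left (e w : Hecke G R) (n : ℕ) :
    (fun f => conv μ hp e f)^[n + 1] w = conv μ hp (convPow μ hp e n) w := by
  induction n with
  | zero => rfl
  | succ n ih => rw [Function.iterate_succ_apply', ih, ← conv_assoc]; rfl

theorem iterate_conv_right (e w : Hecke G R) (n : ℕ) :
    (fun f => conv μ hp f e)^[n + 1] w = conv μ hp w (convPow μ hp e n) := by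
  induction n with
  | zero => rfl
  | succ n ih => rw [Function.iterate_succ_apply', ih, conv_assoc, ← convPow_succ']

theorem exists_convPow_eq_of_iterate_left {e u x : Hecke G R} (hr : conv μ hp e u = e) {n : ℕ}
    (h : (fun f => conv μ hp e f)^[n] (conv μ hp e x) = (fun f => conv μ hp e f)^[n] u) :
    convPow μ hp e n = conv μ hp (convPow μ hp e (n + 1)) x := by
  -- One more factor `e` is applied because `n` may be `0`, while `convPow` starts at the first
  -- power.
  have h1 := congrArg (fun f => conv μ hp e f) h
  simp only [← Function.iterate_succ_apply' (fun f => conv μ hp e f)] at h1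
  rw [iterate_conv_left, iterate_conv_left, convPow_conv_of_right μ hp hr, ← conv_assoc,
    ← convPow_succ'] at h1
  exact h1.symm

theorem exists_convPow_eq_of_iterate_right {e u x : Hecke G R} (hl : conv μ hp u e = e) {n : ℕ}
    (h : (fun f => conv μ hp f e)^[n] (conv μ hp x e) = (fun f => conv μ hp f e)^[n] u) :
    convPow μ hp e n = conv μ hp x (convPow μ hp e (n + 1)) := by
  have h1 := congrArg (fun f => conv μ hp f e) h
  simp only [← Function.iterate_succ_apply' (fun f => conv μ hp f e)] at h1
  rw [iterate_conv_right, iterate_conv_right, conv_convPow_of_left μ hp hl, conv_assoc] at h1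
  exact h1.symm

theorem exists_idealsAgree_of_surjective {e u : Hecke G R} (hl : conv μ hp u e = e)
    (hr : conv μ hp e u = e)
    (h1 : Function.Surjective (limMap fun f => conv μ hp e f))
    (h2 : Function.Surjective (limMap fun f => conv μ hp f e)) :
    ∃ m₀, ∀ m ≥ m₀, IdealsAgree μ hp e m := by
  obtain ⟨x, n, hx⟩ := exists_iterate_eq_of_limMap_surjective h1 u
  obtain ⟨y, k, hy⟩ := exists_iterate_eq_of_limMap_surjective h2 u
  exact exists_idealsAgree μ hp (exists_convPow_eq_of_iterate_left μ hp hr hx)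
    (exists_convPow_eq_of_iterate_right μ hp hl hy)

end Idempotents

/-! ### Well-placed subgroups -/

section Decomposition

variable {G : Type*} [Group G]

/-- Every element of `K` is a product of elements of `K ∩ A`, `K ∩ B` and `K ∩ C`. -/
def Decomposes (K A B C : Subgroup G) : Prop :=
  ∀ k ∈ K, ∃ a ∈ K ⊓ A, ∃ b ∈ K ⊓ B, ∃ c ∈ K ⊓ C, a * b * c = k

theorem MulBijective.decomposes {K A B C : Subgroup G} (h : MulBijective K A B C) :
    Decomposes K A B C := by
  intro k hk
  obtain ⟨⟨a, b, c⟩, habc⟩ := h.2 ⟨k, hk⟩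
  exact ⟨a, a.2, b, b.2, c, c.2, congrArg Subtype.val habc⟩

/-- Injectivity is inherited from `K`; only the existence of factors inside `L` has to be supplied.
-/
theorem MulBijective.of_le {K L A B C : Subgroup G} (h : MulBijective K A B C) (hL : L ≤ K)
    (hd : Decomposes L A B C) : MulBijective L A B C := by
  constructor
  · rintro ⟨a, b, c⟩ ⟨a', b', c'⟩ he
    have he' : a.1 * b.1 * c.1 = a'.1 * b'.1 * c'.1 := congrArg Subtype.val he
    have h1 := h.1 (a₁ := (⟨a.1, hL a.2.1, a.2.2⟩, ⟨b.1, hL b.2.1, b.2.2⟩, ⟨c.1, hL c.2.1, c.2.2⟩))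
      (a₂ := (⟨a'.1, hL a'.2.1, a'.2.2⟩, ⟨b'.1, hL b'.2.1, b'.2.2⟩, ⟨c'.1, hL c'.2.1, c'.2.2⟩))
      (Subtype.ext he')
    have h2 : a.1 = a'.1 := congrArg (fun t => t.1.1) h1
    have h3 : b.1 = b'.1 := congrArg (fun t => t.2.1.1) h1
    have h4 : c.1 = c'.1 := congrArg (fun t => t.2.2.1) h1
    exact Prod.ext (Subtype.ext h2) (Prod.ext (Subtype.ext h3) (Subtype.ext h4))
  · rintro ⟨k, hk⟩
    obtain ⟨a, ha, b, hb, c, hc, habc⟩ := hd k hk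
    exact ⟨(⟨a, ha⟩, ⟨b, hb⟩, ⟨c, hc⟩), Subtype.ext habc⟩

/-- `M` normalises `U` and `U'`, and the multiplication map `U' × M × U → G` is injective. -/
structure IsTriangular (U M U' : Subgroup G) : Prop where
  conj : ∀ m ∈ M, ∀ u ∈ U, m * u * m⁻¹ ∈ U
  conj' : ∀ m ∈ M, ∀ u ∈ U', m * u * m⁻¹ ∈ U'
  inj : ∀ u' ∈ U', ∀ m ∈ M, ∀ u ∈ U, u' * m * u = 1 → u' = 1 ∧ m = 1 ∧ u = 1

variable {U M U' : Subgroup G}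

theorem IsTriangular.symm (h : IsTriangular U M U') : IsTriangular U' M U where
  conj := h.conj'
  conj' := h.conj
  inj u hu m hm u' hu' e := by
    have := h.inj u'⁻¹ (U'.inv_mem hu') m⁻¹ (M.inv_mem hm) u⁻¹ (U.inv_mem hu) (by
      rw [← inv_eq_one.2 e]; group)
    simpa [and_comm, and_assoc, and_left_comm] using this

theorem IsTriangular.unique (h : IsTriangular U M U') {a a' b b' c c' : G} (ha : a ∈ U')
    (ha' : a' ∈ U') (hb : b ∈ M) (hb' : b' ∈ M) (hc : c ∈ U) (hc' : c' ∈ U)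
    (e : a * b * c = a' * b' * c') : a = a' ∧ b = b' ∧ c = c' := by
  have h1 := h.inj (a'⁻¹ * a) (U'.mul_mem (U'.inv_mem ha') ha) (b * b'⁻¹)
    (M.mul_mem hb (M.inv_mem hb')) (b' * (c * c'⁻¹) * b'⁻¹)
    (h.conj b' hb' _ (U.mul_mem hc (U.inv_mem hc'))) (by
      have : a'⁻¹ * a * (b * b'⁻¹) * (b' * (c * c'⁻¹) * b'⁻¹) =
        a'⁻¹ * (a * b * c) * c'⁻¹ * b'⁻¹ := by group
      rw [this, e]
      group)
  obtain ⟨h1, h2, h3⟩ := h1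
  refine ⟨(inv_mul_eq_one.1 h1).symm, mul_inv_eq_one.1 h2, mul_inv_eq_one.1 ?_⟩
  exact conj_eq_one_iff.1 h3

/-- The factors found in `K` and in `L` coincide by uniqueness, hence lie in both. -/
theorem Decomposes.inf (h : IsTriangular U M U') {K L : Subgroup G} (hK : Decomposes K U' M U)
    (hL : Decomposes L U' M U) : Decomposes (K ⊓ L) U' M U := by
  rintro k ⟨hk, hk'⟩
  obtain ⟨a, ha, b, hb, c, hc, e⟩ := hK k hk
  obtain ⟨a', ha', b', hb', c', hc', e'⟩ := hL k hk'
  obtain ⟨rfl, rfl, rfl⟩ := h.unique ha.2 ha'.2 hb.2 hb'.2 hc.2 hc'.2 (e.trans e'.symm)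
  exact ⟨a, ⟨⟨ha.1, ha'.1⟩, ha.2⟩, b, ⟨⟨hb.1, hb'.1⟩, hb.2⟩, c, ⟨⟨hc.1, hc'.1⟩, hc.2⟩, e⟩

theorem Decomposes.conjSub {K A B C : Subgroup G} (h : Decomposes K A B C) (g : G)
    (hA : ∀ x ∈ A, g * x * g⁻¹ ∈ A) (hB : ∀ x ∈ B, g * x * g⁻¹ ∈ B)
    (hC : ∀ x ∈ C, g * x * g⁻¹ ∈ C) : Decomposes (conjSub g K) A B C := by
  intro k hk
  obtain ⟨a, ha, b, hb, c, hc, e⟩ := h _ (mem_conjSub.1 hk)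
  refine ⟨g * a * g⁻¹, ⟨?_, hA a ha.2⟩, g * b * g⁻¹, ⟨?_, hB b hb.2⟩, g * c * g⁻¹,
    ⟨?_, hC c hc.2⟩, ?_⟩
  · exact mem_conjSub.2 (by simpa [mul_assoc] using ha.1)
  · exact mem_conjSub.2 (by simpa [mul_assoc] using hb.1)
  · exact mem_conjSub.2 (by simpa [mul_assoc] using hc.1)
  · have : g * a * g⁻¹ * (g * b * g⁻¹) * (g * c * g⁻¹) = g * (a * b * c) * g⁻¹ := by group
    rw [this, e]
    group

theorem MulBijective.conjSub {K A B C : Subgroup G} (h : MulBijective K A B C) (g : G)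
    (hA : ∀ x, x ∈ A ↔ g * x * g⁻¹ ∈ A) (hB : ∀ x, x ∈ B ↔ g * x * g⁻¹ ∈ B)
    (hC : ∀ x, x ∈ C ↔ g * x * g⁻¹ ∈ C) : MulBijective (conjSub g K) A B C := by
  constructor
  · rintro ⟨a, b, c⟩ ⟨a', b', c'⟩ he
    have key : ∀ {D : Subgroup G}, (∀ x, x ∈ D ↔ g * x * g⁻¹ ∈ D) →
        ∀ x ∈ StabAdj.conjSub g K ⊓ D, g⁻¹ * x * g ∈ K ⊓ D := fun hD x hx =>
      ⟨mem_conjSub.1 hx.1, (hD _).2 (by simpa [mul_assoc] using hx.2)⟩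
    have h1 := h.1 (a₁ := (⟨_, key hA _ a.2⟩, ⟨_, key hB _ b.2⟩, ⟨_, key hC _ c.2⟩))
      (a₂ := (⟨_, key hA _ a'.2⟩, ⟨_, key hB _ b'.2⟩, ⟨_, key hC _ c'.2⟩))
      (Subtype.ext (by
        have := congrArg (fun x => g⁻¹ * x.1 * g) he
        simpa [mul_assoc] using this))
    have h2 : g⁻¹ * a.1 * g = g⁻¹ * a'.1 * g := congrArg (fun t => t.1.1) h1
    have h3 : g⁻¹ * b.1 * g = g⁻¹ * b'.1 * g := congrArg (fun t => t.2.1.1) h1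
    have h4 : g⁻¹ * c.1 * g = g⁻¹ * c'.1 * g := congrArg (fun t => t.2.2.1) h1
    simp only [mul_left_inj, mul_right_inj] at h2 h3 h4
    exact Prod.ext (Subtype.ext h2) (Prod.ext (Subtype.ext h3) (Subtype.ext h4))
  · rintro ⟨k, hk⟩
    obtain ⟨a, ha, b, hb, c, hc, habc⟩ := h.decomposes.conjSub g (fun x => (hA x).1)
      (fun x => (hB x).1) (fun x => (hC x).1) k hk
    exact ⟨(⟨a, ha⟩, ⟨b, hb⟩, ⟨c, hc⟩), Subtype.ext habc⟩

theorem IsTriangular.conj_iff (h : IsTriangular U M U') {m : G} (hm : m ∈ M) (x : G) :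
    x ∈ U ↔ m * x * m⁻¹ ∈ U := by
  refine ⟨h.conj m hm x, fun hx => ?_⟩
  have := h.conj _ (M.inv_mem hm) _ hx
  simpa [mul_assoc] using this

variable [TopologicalSpace G] [IsTopologicalGroup G] {p : ℕ} {K L : Subgroup G}

theorem WellPlaced.symm (h : WellPlaced p U M U' K) : WellPlaced p U' M U K :=
  ⟨h.1, h.2.2.2.2.2.2, h.2.2.2.2.2.1, h.2.2.2.2.1, h.2.2.2.1, h.2.2.1, h.2.1⟩

theorem WellPlaced.decomposes (h : WellPlaced p U M U' K) : Decomposes K U' M U :=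
  h.2.2.2.2.2.2.decomposes

theorem WellPlaced.conjSub (ht : IsTriangular U M U') (h : WellPlaced p U M U' K) {m : G}
    (hm : m ∈ M) : WellPlaced p U M U' (conjSub m K) := by
  obtain ⟨h0, h1, h2, h3, h4, h5, h6⟩ := h
  have hU := ht.conj_iff hm
  have hU' := ht.symm.conj_iff hm
  have hM : ∀ x, x ∈ M ↔ m * x * m⁻¹ ∈ M := fun x => by
    rw [M.mul_mem_cancel_right (M.inv_mem hm), M.mul_mem_cancel_left hm]
  exact ⟨h0.conjSub m, h1.conjSub m hU hM hU', h2.conjSub m hU hU' hM, h3.conjSub m hM hU hU',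
    h4.conjSub m hM hU' hU, h5.conjSub m hU' hU hM, h6.conjSub m hU' hM hU⟩

theorem Decomposes.inv {K A B C : Subgroup G} (h : Decomposes K A B C) : Decomposes K C B A := by
  intro k hk
  obtain ⟨a, ha, b, hb, c, hc, e⟩ := h k⁻¹ (K.inv_mem hk)
  refine ⟨c⁻¹, inv_mem hc, b⁻¹, inv_mem hb, a⁻¹, inv_mem ha, ?_⟩
  rw [← inv_inv k, ← e]
  group

/-- A factor moves past one that normalises its subgroup. Together with inversion, which reverses
the order, this yields all six orderings from one. -/
theorem Decomposes.swap_left {K A B C : Subgroup G} (h : Decomposes K A B C)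
    (hA : ∀ m ∈ B, ∀ u ∈ A, m * u * m⁻¹ ∈ A) : Decomposes K B A C := by
  intro k hk
  obtain ⟨a, ha, b, hb, c, hc, e⟩ := h k hk
  refine ⟨b, hb, b⁻¹ * a * b, ⟨?_, ?_⟩, c, hc, ?_⟩
  · exact K.mul_mem (K.mul_mem (K.inv_mem hb.1) ha.1) hb.1
  · simpa using hA b⁻¹ (inv_mem hb.2) a ha.2
  · rw [← e]
    group

theorem Decomposes.swap_right {K A B C : Subgroup G} (h : Decomposes K A B C)
    (hC : ∀ m ∈ B, ∀ u ∈ C, m * u * m⁻¹ ∈ C) : Decomposes K A C B :=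
  (h.inv.swap_left hC).inv

/-- An open subgroup of a well-placed subgroup is well-placed once it has one decomposition. -/
theorem WellPlaced.of_le (ht : IsTriangular U M U') (h : WellPlaced p U M U' K) (hpp : p.Prime)
    (hL : IsOpen (L : Set G)) (hLK : L ≤ K) (hd : Decomposes L U M U') : WellPlaced p U M U' L := by
  obtain ⟨h0, h1, h2, h3, h4, h5, h6⟩ := h
  exact ⟨h0.mono hpp hL hLK, h1.of_le hLK hd, h2.of_le hLK (hd.swap_right ht.conj'),
    h3.of_le hLK (hd.swap_left ht.conj), h4.of_le hLK (hd.inv.swap_left ht.conj'),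
    h5.of_le hLK (hd.inv.swap_right ht.conj), h6.of_le hLK hd.inv⟩

variable {z : G}

theorem StrictlyPositive.inv (h : StrictlyPositive U M U' K z) :
    StrictlyPositive U' M U K z⁻¹ where
  mem := M.inv_mem h.mem
  central m hm := by
    rw [inv_mul_eq_iff_eq_mul, ← mul_assoc, h.central m hm, mul_inv_cancel_right]
  mono u hu := by simpa using h.mono' u hu
  mono' u hu := by simpa using h.mono u hu
  iUnion := by simpa using h.iUnion'
  iInter := by simpa using h.iInter'
  iUnion' := by simpa using h.iUnion
  iInter' := by simpa using h.iInter

theorem StrictlyPositive.pow_mem' (h : StrictlyPositive U M U' K z) {u : G} (hu : u ∈ K ⊓ U')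
    (n : ℕ) : z ^ n * u * (z ^ n)⁻¹ ∈ K ⊓ U' := by
  induction n with
  | zero => simpa using hu
  | succ n ih =>
    have := h.mono' _ ih
    rw [pow_succ', mul_inv_rev]
    simpa only [mul_assoc] using this

theorem StrictlyPositive.pow_mem (h : StrictlyPositive U M U' K z) {u : G} (hu : u ∈ K ⊓ U)
    (n : ℕ) : (z ^ n)⁻¹ * u * z ^ n ∈ K ⊓ U := by
  simpa using h.inv.pow_mem' hu n

theorem StrictlyPositive.exists_pow_mem (h : StrictlyPositive U M U' K z) {u : G} (hu : u ∈ U') :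
    ∃ n, ∀ i ≥ n, z ^ i * u * (z ^ i)⁻¹ ∈ K := by
  have hu' : u ∈ (U' : Set G) := hu
  rw [← h.iUnion', Set.mem_iUnion] at hu'
  obtain ⟨n, w, hw, rfl⟩ := hu'
  refine ⟨n, fun i hi => ?_⟩
  obtain ⟨j, rfl⟩ := Nat.exists_eq_add_of_le hi
  have := (h.pow_mem' hw j).1
  rw [add_comm, pow_add]
  simpa [mul_assoc] using this

theorem StrictlyPositive.pow_central (h : StrictlyPositive U M U' K z) (n : ℕ) {m : G}
    (hm : m ∈ M) : z ^ n * m = m * z ^ n :=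
  (Commute.pow_left (show Commute z m from h.central m hm) n).eq

end Decomposition

/-! ### The roughening and the natural map -/

section Rough

variable {G : Type*} [Group G] [TopologicalSpace G] [IsTopologicalGroup G] [MeasurableSpace G]
  [BorelSpace G] {p : ℕ} (μ : MeasureTheory.Measure G) [ProPHaar p μ] {R : Type*} [Ring R]
  (hp : IsUnit (p : R)) {V : Type*} [AddCommGroup V] [Module R V]
  {π : G →* Module.End R V} {U M U' K L : Subgroup G} {z : G}

theorem toCoinv_rep {u : G} (hu : u ∈ U') (v : V) : toCoinv π U' (π u v) = toCoinv π U' v := by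
  rw [toCoinv, toCoinv, Submodule.Quotient.eq]
  exact Submodule.subset_span ⟨u, hu, v, rfl⟩

theorem toCoinv_rep_congr {m : G} (hm : ∀ u ∈ U', m * u * m⁻¹ ∈ U') {v w : V}
    (h : toCoinv π U' v = toCoinv π U' w) : toCoinv π U' (π m v) = toCoinv π U' (π m w) := by
  rw [toCoinv, toCoinv, Submodule.Quotient.eq] at h ⊢
  rw [← map_sub]
  have hle : Submodule.span R {x : V | ∃ u ∈ U', ∃ v : V, x = π u v - v} ≤
      (Submodule.span R {x : V | ∃ u ∈ U', ∃ v : V, x = π u v - v}).comap (π m) := by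
    rw [Submodule.span_le]
    rintro _ ⟨u, hu, v, rfl⟩
    refine Submodule.subset_span ⟨m * u * m⁻¹, hm u hu, π m v, ?_⟩
    rw [map_sub, ← rep_mul, ← rep_mul]
    simp
  exact hle h

variable {μ hp}

theorem RoughFixed.rep_eq {v : Rough μ hp π} {g : G} (h : RoughFixed μ hp π v g)
    {N L : Subgroup G} (hN : IsOpenProP p N) (hL : ∀ k ∈ L, ∀ x ∈ N, k * x * k⁻¹ ∈ N)
    (hg : g ∈ L) : π g (v.1 ⟨N, hN⟩) = v.1 ⟨N, hN⟩ := by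
  refine h ⟨N, hN⟩ ⟨N, hN⟩ fun x => ⟨hL g hg x, fun hx => ?_⟩
  have := hL g⁻¹ (L.inv_mem hg) _ hx
  simpa [mul_assoc] using this

/-- Here `v_L = e_L v_N` is an average over `L`. As `L` normalises `N`, the factors in `U` and `M`
fix `v_N`, while the factor in `U'` disappears in the coinvariants. -/
theorem toCoinv_rough_eq_of_normal (hπ : IsSmooth π) {v : Rough μ hp π}
    (hU : ∀ u ∈ U, RoughFixed μ hp π v u) (hL : IsOpenProP p L) (hd : Decomposes L U' M U)
    (hM : ∀ m ∈ L ⊓ M, RoughFixed μ hp π v m) {N : Subgroup G} (hN : IsOpenProP p N)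
    (hNL : N ≤ L) (hn : ∀ k ∈ L, ∀ x ∈ N, k * x * k⁻¹ ∈ N) :
    toCoinv π U' (v.1 ⟨L, hL⟩) = toCoinv π U' (v.1 ⟨N, hN⟩) := by
  rw [← v.2.2 ⟨N, hN⟩ ⟨L, hL⟩ hNL]
  refine map_idem_eq μ hp hπ hL (Submodule.mkQ _) fun k hk => ?_
  obtain ⟨a, ha, b, hb, c, hc, rfl⟩ := hd k hk
  rw [rep_mul, rep_mul, (hU c hc.2).rep_eq hN hn hc.1, (hM b hb).rep_eq hN hn hb.1]
  exact toCoinv_rep ha.2 _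

theorem toCoinv_rough_eq_of_le (hπ : IsSmooth π) {v : Rough μ hp π}
    (hU : ∀ u ∈ U, RoughFixed μ hp π v u) (hL : IsOpenProP p L) (hd : Decomposes L U' M U)
    (hM : ∀ m ∈ L ⊓ M, RoughFixed μ hp π v m) {J : Subgroup G} (hJ : IsOpenProP p J)
    (hJL : J ≤ L) (hdJ : Decomposes J U' M U) :
    toCoinv π U' (v.1 ⟨L, hL⟩) = toCoinv π U' (v.1 ⟨J, hJ⟩) := by
  obtain ⟨N, hN, hNJ, hNL, hn⟩ := hL.exists_normal_le (ProPHaar.prime μ) hJ.1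
  rw [toCoinv_rough_eq_of_normal hπ hU hL hd hM hN hNL hn,
    toCoinv_rough_eq_of_normal hπ hU hJ hdJ (fun m hm => hM m ⟨hJL hm.1, hm.2⟩) hN hNJ
      fun k hk => hn k (hJL hk)]

/-- The natural map can be computed with any well-placed subgroup. -/
theorem natMap_eq (ht : IsTriangular U M U') (hπ : IsSmooth π) {v : Rough μ hp π}
    (hU : ∀ u ∈ U, RoughFixed μ hp π v u) (hL : WellPlaced p U M U' L)
    (hM : ∀ m ∈ L ⊓ M, RoughFixed μ hp π v m) :
    natMap μ hp π U M U' v = toCoinv π U' (v.1 ⟨L, hL.1⟩) := by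
  have h : ∃ L : {K : Subgroup G // IsOpenProP p K},
      WellPlaced p U M U' L.1 ∧ ∀ m ∈ L.1 ⊓ M, RoughFixed μ hp π v m := ⟨⟨L, hL.1⟩, hL, hM⟩
  rw [natMap, dif_pos h]
  obtain ⟨h1, h2⟩ := h.choose_spec
  set J := h.choose
  -- The chosen subgroup and `L` are compared through their intersection, which still decomposes.
  have hJL : IsOpenProP p (J.1 ⊓ L) := hL.1.mono (ProPHaar.prime μ) (J.2.1.inter hL.1.1) inf_le_right
  have hd : Decomposes (J.1 ⊓ L) U' M U := Decomposes.inf ht h1.decomposes hL.decomposes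
  rw [toCoinv_rough_eq_of_le hπ hU hL.1 hL.decomposes hM hJL inf_le_right hd,
    ← toCoinv_rough_eq_of_le hπ hU J.2 h1.decomposes h2 hJL inf_le_left hd]

variable (μ hp)

/-- On a generator `π u v - v`, conjugation by `z ^ i` carries `u ∈ U'` into `K` for large `i`, and
`e_K` then absorbs it. A general element involves finitely many generators. -/
theorem exists_idem_pow_eq_zero (hπ : IsSmooth π) (hK : IsOpenProP p K)
    (hz : StrictlyPositive U M U' K z) {w : V} (hw : toCoinv π U' w = 0) :
    ∃ n, ∀ i ≥ n, heckeAct μ hp π (idem μ hp K hK) (π (z ^ i) w) = 0 := by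
  rw [toCoinv, Submodule.Quotient.mk_eq_zero] at hw
  simp only [← idemLin_apply μ hp hπ hK]
  induction hw using Submodule.span_induction with
  | mem x hx =>
    obtain ⟨u, hu, v, rfl⟩ := hx
    obtain ⟨n, hn⟩ := hz.exists_pow_mem hu
    refine ⟨n, fun i hi => ?_⟩
    have : z ^ i * u = z ^ i * u * (z ^ i)⁻¹ * z ^ i := by group
    rw [map_sub, ← rep_mul, this, rep_mul, map_sub, idemLin_apply, idem_rep μ hp hπ hK (hn i hi),
      ← idemLin_apply μ hp hπ hK, sub_self]
  | zero => exact ⟨0, fun i _ => by rw [map_zero, map_zero]⟩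
  | add x y _ _ hx hy =>
    obtain ⟨n, hn⟩ := hx
    obtain ⟨k, hk⟩ := hy
    refine ⟨max n k, fun i hi => ?_⟩
    rw [map_add, map_add, hn i (le_of_max_le_left hi), hk i (le_of_max_le_right hi), add_zero]
  | smul r x _ hx =>
    obtain ⟨n, hn⟩ := hx
    exact ⟨n, fun i hi => by rw [map_smul, map_smul, hn i hi, smul_zero]⟩

/-- The inner `e_K` in `e_K z e_K z ^ n w` is redundant. For `a * b * c ∈ K`, the factor `a ∈ U'`
moves left past `z` and is absorbed by the outer `e_K`; `b` and `c` move right past `z ^ n` and stay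
in `K`, which fixes `w`. -/
theorem iterate_dblIdem (hπ : IsSmooth π) (hK : IsOpenProP p K) (hd : Decomposes K U' M U)
    (hz : StrictlyPositive U M U' K z) {w : V} (hw : ∀ k ∈ K, π k w = w) (n : ℕ) :
    (heckeAct μ hp π (dblIdem μ hp K hK z))^[n] w =
      heckeAct μ hp π (idem μ hp K hK) (π (z ^ n) w) := by
  induction n with
  | zero => simpa [rep_one] using (idem_eq_self μ hp hπ hK hw).symm
  | succ n ih =>
    rw [Function.iterate_succ_apply', ih, heckeAct_dblIdem μ hp hπ,
      idem_eq_self μ hp hπ hK fun k hk => rep_idem μ hp hπ hK hk _]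
    refine map_idem_eq μ hp hπ hK ((idemLin μ hp hπ hK).comp (π z)) fun k hk => ?_
    obtain ⟨a, ha, b, hb, c, hc, rfl⟩ := hd k hk
    have h1 : z * (a * b * c) * z ^ n =
        (z * a * z⁻¹) * (z ^ (n + 1) * (b * ((z ^ n)⁻¹ * c * z ^ n))) := by
      rw [pow_succ', mul_assoc z (z ^ n), ← mul_assoc (z ^ n) b, hz.pow_central n hb.2]
      group
    rw [LinearMap.comp_apply, idemLin_apply, ← rep_mul, ← rep_mul, h1, rep_mul,
      idem_rep μ hp hπ hK (hz.mono' a ha).1, rep_mul,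
      hw _ (K.mul_mem hb.1 (hz.pow_mem hc n).1)]

variable {μ hp}

/-- If `v` is invariant under `U` and `K ∩ M`, then `v_K = e_{K z K} (z⁻¹ v)_K`. -/
theorem dblIdem_rough (ht : IsTriangular U M U') (hπ : IsSmooth π) {v : Rough μ hp π}
    (hU : ∀ u ∈ U, RoughFixed μ hp π v u) (hK : IsOpenProP p K) (hd : Decomposes K U' M U)
    (hM : ∀ m ∈ K ⊓ M, RoughFixed μ hp π v m) (hz : StrictlyPositive U M U' K z) :
    heckeAct μ hp π (dblIdem μ hp K hK z) (π z⁻¹ (v.1 ⟨conjSub z K, hK.conjSub z⟩)) =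
      v.1 ⟨K, hK⟩ := by
  have h0 : ∀ k ∈ K, π k (π z⁻¹ (v.1 ⟨conjSub z K, hK.conjSub z⟩)) =
      π z⁻¹ (v.1 ⟨conjSub z K, hK.conjSub z⟩) := by
    intro k hk
    have : k * z⁻¹ = z⁻¹ * (z * k * z⁻¹) := by group
    rw [← rep_mul, this, rep_mul, v.2.1]
    simpa [mem_conjSub, mul_assoc] using hk
  rw [heckeAct_dblIdem μ hp hπ, idem_eq_self μ hp hπ hK h0, ← rep_mul, mul_inv_cancel, rep_one]
  -- It remains to see that `e_K` sends the component of `v` at `z K z⁻¹` to `v_K`. That component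
  -- is the average of `v_N` over `z K z⁻¹`; the factors in `M` and `U` fix `v_N`, and the factor in
  -- `U'` lies in `K` and is absorbed by `e_K`.
  obtain ⟨N, hN, hNK, hNK', hn⟩ :=
    (hK.conjSub z).exists_normal_le (ProPHaar.prime μ) hK.1
  rw [← v.2.2 ⟨N, hN⟩ ⟨_, hK.conjSub z⟩ hNK']
  refine map_idem_eq μ hp hπ (hK.conjSub z) (idemLin μ hp hπ hK) fun k hk => ?_
  obtain ⟨a, ha, b, hb, c, hc, e⟩ := hd _ (mem_conjSub.1 hk)
  have h1 : k = (z * a * z⁻¹) * (b * (z * c * z⁻¹)) := by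
    have h2 : k = z * (a * b * c) * z⁻¹ := by
      rw [e]
      group
    have h3 : z * b * z⁻¹ = b := by rw [hz.central b hb.2, mul_inv_cancel_right]
    rw [h2]
    nth_rw 2 [← h3]
    group
  have h4 : z * c * z⁻¹ ∈ conjSub z K := by simpa [mem_conjSub, mul_assoc] using hc.1
  have h5 : b ∈ conjSub z K := by
    rw [mem_conjSub, mul_assoc, ← hz.central b hb.2, inv_mul_cancel_left]
    exact hb.1
  rw [h1, rep_mul π (z * a * z⁻¹), rep_mul π b, (hU _ (ht.conj z hz.mem c hc.2)).rep_eq hN hn h4,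
    (hM b hb).rep_eq hN hn h5, idemLin_apply, idem_rep μ hp hπ hK (hz.mono' a ha).1]
  exact v.2.2 ⟨N, hN⟩ ⟨K, hK⟩ hNK

theorem exists_iterate_eq (ht : IsTriangular U M U') (hπ : IsSmooth π) {v : Rough μ hp π}
    (hU : ∀ u ∈ U, RoughFixed μ hp π v u) (hK : IsOpenProP p K) (hKp : WellPlaced p U M U' K)
    (hM : ∀ m ∈ K ⊓ M, RoughFixed μ hp π v m) (hz : StrictlyPositive U M U' K z) {w : V}
    (hw : ∀ k ∈ K, π k w = w) (hv : natMap μ hp π U M U' v = toCoinv π U' w) :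
    ∃ (x : V) (n : ℕ), (heckeAct μ hp π (dblIdem μ hp K hK z))^[n]
      (heckeAct μ hp π (dblIdem μ hp K hK z) x) =
        (heckeAct μ hp π (dblIdem μ hp K hK z))^[n] w := by
  have hd := hKp.decomposes
  rw [natMap_eq ht hπ hU hKp hM, ← sub_eq_zero] at hv
  obtain ⟨n, hn⟩ := exists_idem_pow_eq_zero μ hp hπ hK hz (w := v.1 ⟨K, hK⟩ - w) hv
  refine ⟨π z⁻¹ (v.1 ⟨conjSub z K, hK.conjSub z⟩), n, ?_⟩
  rw [dblIdem_rough ht hπ hU hK hd hM hz, iterate_dblIdem μ hp hπ hK hd hz (v.2.1 ⟨K, hK⟩),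
    iterate_dblIdem μ hp hπ hK hd hz hw, ← sub_eq_zero, ← hn n le_rfl]
  simp only [← idemLin_apply μ hp hπ hK, map_sub]

end Rough

/-! ### Right multiplication -/

section Flip

variable {G : Type*} [Group G] [TopologicalSpace G] [IsTopologicalGroup G] [MeasurableSpace G]
  [BorelSpace G] {p : ℕ} (μ : MeasureTheory.Measure G) [ProPHaar p μ] {R : Type*} [Ring R]
  (hp : IsUnit (p : R)) {K : Subgroup G}

theorem flip_idem (hK : IsOpenProP p K) :
    flip (idem μ hp K hK) = (idem μ hp K hK : Hecke G R) := by
  ext x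
  exact idem_apply_congr μ hp hK (by rw [K.inv_mem_iff])

theorem flip_conv (f h : Hecke G R) :
    flip (conv μ hp f h) = heckeAct μ hp (rightReg G R) f (flip h) := by
  let A : Hecke G R →ₗ[R] Hecke G R :=
    { toFun := flip
      map_add' := fun _ _ => rfl
      map_smul' := fun _ _ => rfl }
  rw [conv_eq_heckeAct]
  refine heckeAct_map μ hp (isSmooth_leftReg μ (p := p)) A (fun g v => ?_) f h
  ext x
  change v.1 (g⁻¹ * x⁻¹) = v.1 ((x * g)⁻¹)
  rw [mul_inv_rev]

theorem modFactor_commute (K : Subgroup G) (g : G) (r : R) :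
    Commute r (modFactor μ hp K g : R) := by
  rw [modFactor, Units.val_mul]
  exact (vol_commute μ hp _ r).symm.mul_right (Commute.units_inv_right (vol_commute μ hp K r).symm)

theorem modFactor_one (K : Subgroup G) : (modFactor μ hp K 1 : Rˣ) = 1 := by
  rw [modFactor, conjSub_one, mul_inv_cancel]

/-- After the substitution `y ↦ x * y` only a right translation by `g` remains, which contributes
the modular factor. -/
theorem conv_leftReg_idem (hK : IsOpenProP p K) (g : G) (f : Hecke G R) :
    conv μ hp f (leftReg G R g (idem μ hp K hK)) = (modFactor μ hp K g : R) •
      heckeAct μ hp (rightReg G R) (idem μ hp K hK) (rightReg G R g⁻¹ f) := by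
  ext x
  obtain ⟨L, hL, h1⟩ := exists_rightInv_smul (p := p) μ (isSmooth_leftReg (p := p) μ) f
    (leftReg G R g (idem μ hp K hK))
  have h2 : RightInv L fun y => f.1 y * (idem μ hp K hK).1 (g⁻¹ * (y⁻¹ * x)) := fun y l hl =>
    congrFun (congrArg Subtype.val (h1 y l hl)) x
  obtain ⟨J, hJ, h3⟩ := exists_rightInv_smul (p := p) μ (isSmooth_rightReg (p := p) μ)
    (idem μ hp K hK) (rightReg G R g⁻¹ f)
  have h4 : RightInv J fun y => (idem μ hp K hK).1 y * f.1 (x * y * g⁻¹) := fun y l hl =>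
    congrFun (congrArg Subtype.val (h3 y l hl)) x |> fun h => by
      simpa [rightReg, mul_assoc] using h
  let A : Hecke G R →ₗ[R] R := (LinearMap.proj x).comp (Hecke G R).subtype
  have h5 : (heckeAct μ hp (rightReg G R) (idem μ hp K hK) (rightReg G R g⁻¹ f)).1 x =
      haarInt μ hp fun y => (idem μ hp K hK).1 y * f.1 (x * y * g⁻¹) := by
    have := haarInt_map μ hp A hJ h3 (hasCompactSupport_smul _ _)
    refine this.trans ?_
    congr 1
  change haarInt μ hp (fun y => f.1 y * (idem μ hp K hK).1 (g⁻¹ * (y⁻¹ * x))) =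
    (modFactor μ hp K g : R) •
      (heckeAct μ hp (rightReg G R) (idem μ hp K hK) (rightReg G R g⁻¹ f)).1 x
  rw [h5, ← haarInt_mul_right μ hp hK g hJ h4 (idem μ hp K hK).2.2.mul_right,
    ← haarInt_mul_left μ hp x hL h2 f.2.2.mul_right]
  congr 1
  funext y
  rw [mul_assoc x (y * g), mul_inv_cancel_right, ← (idem_commute μ hp hK _ _).eq]
  congr 1
  refine idem_apply_congr μ hp hK ?_
  rw [← K.inv_mem_iff]
  simp [mul_assoc]

/-- Right multiplication by `e_{K g K}` is, up to a central unit, conjugate to left multiplication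
by `e_{K g⁻¹ K}`. -/
theorem conv_dblIdem (hK : IsOpenProP p K) (g : G) (f : Hecke G R) :
    conv μ hp f (dblIdem μ hp K hK g) =
      (modFactor μ hp K g : R) • flip (conv μ hp (dblIdem μ hp K hK g⁻¹) (flip f)) := by
  have h1 := conv_leftReg_idem μ hp hK 1 f
  rw [modFactor_one, Units.val_one, one_smul, inv_one, rep_one, rep_one] at h1
  rw [flip_conv, flip_flip, heckeAct_dblIdem μ hp (isSmooth_rightReg μ (p := p)), ← h1,
    ← conv_leftReg_idem, conv_assoc, ← dblIdem]

theorem iterate_conv_smul (e : Hecke G R) {r : R} (hr : ∀ s : R, Commute r s) (n : ℕ)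
    (f : Hecke G R) : (fun f => conv μ hp e f)^[n] (r • f) = r • (fun f => conv μ hp e f)^[n] f := by
  induction n with
  | zero => rfl
  | succ n ih =>
    rw [Function.iterate_succ_apply', ih, Function.iterate_succ_apply']
    simp only [conv_eq_heckeAct]
    exact heckeAct_smul μ hp (isSmooth_leftReg μ (p := p)) e r (fun x => hr _) _

theorem iterate_conv_dblIdem (hK : IsOpenProP p K) (g : G) (n : ℕ) (f : Hecke G R) :
    (fun f => conv μ hp f (dblIdem μ hp K hK g))^[n] f =
      (modFactor μ hp K g : R) ^ n •
        flip ((fun f => conv μ hp (dblIdem μ hp K hK g⁻¹) f)^[n] (flip f)) := by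
  induction n with
  | zero => simp [flip_flip]
  | succ n ih =>
    rw [Function.iterate_succ_apply', ih, conv_dblIdem, pow_succ', mul_smul]
    congr 1
    set c : R := (modFactor μ hp K g : R) ^ n with hc
    have hcc : ∀ s : R, Commute c s := fun s =>
      (Commute.pow_right (modFactor_commute μ hp K g s) n).symm
    have h1 : ∀ h : Hecke G R, flip (c • flip h) = c • h := fun h => by
      change c • flip (flip h) = _
      rw [flip_flip]
    rw [h1, Function.iterate_succ_apply']
    have := iterate_conv_smul μ hp (dblIdem μ hp K hK g⁻¹) hcc 1
      ((fun f => conv μ hp (dblIdem μ hp K hK g⁻¹) f)^[n] (flip f))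
    simp only [Function.iterate_one] at this
    rw [this]
    rfl

theorem iterate_eq_flip (hK : IsOpenProP p K) (g : G) {x : Hecke G R} {n : ℕ}
    (h : (fun f => conv μ hp (dblIdem μ hp K hK g⁻¹) f)^[n] (conv μ hp (dblIdem μ hp K hK g⁻¹) x) =
      (fun f => conv μ hp (dblIdem μ hp K hK g⁻¹) f)^[n] (idem μ hp K hK)) :
    ∃ y, (fun f => conv μ hp f (dblIdem μ hp K hK g))^[n] (conv μ hp y (dblIdem μ hp K hK g)) =
      (fun f => conv μ hp f (dblIdem μ hp K hK g))^[n] (idem μ hp K hK) := by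
  set c := modFactor μ hp K g with hc
  -- The left side has one more right multiplication than the right side, hence one more factor `c`;
  -- `c⁻¹` compensates for it.
  refine ⟨((c⁻¹ : Rˣ) : R) • flip x, ?_⟩
  have hcc : ∀ s : R, Commute ((c⁻¹ : Rˣ) : R) s := fun s =>
    (Commute.units_inv_right (modFactor_commute μ hp K g s)).symm
  have h1 : flip (((c⁻¹ : Rˣ) : R) • flip x) = ((c⁻¹ : Rˣ) : R) • x := by
    change ((c⁻¹ : Rˣ) : R) • flip (flip x) = _
    rw [flip_flip]
  change (fun f => conv μ hp f (dblIdem μ hp K hK g))^[n + 1] _ = _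
  rw [iterate_conv_dblIdem, h1, iterate_conv_smul μ hp _ hcc, Function.iterate_succ_apply, h,
    iterate_conv_dblIdem, flip_idem, ← hc]
  change (c : R) ^ (n + 1) • ((c⁻¹ : Rˣ) : R) • flip _ = _
  rw [smul_smul, pow_succ, mul_assoc, Units.mul_inv, mul_one]

end Flip

/-! ### Stabilisation -/

section Stabilisation

variable {G : Type*} [Group G] [TopologicalSpace G] [IsTopologicalGroup G] [MeasurableSpace G]
  [BorelSpace G] {p : ℕ} (μ : MeasureTheory.Measure G) [ProPHaar p μ] {R : Type*} [Ring R]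
  (hp : IsUnit (p : R)) {U M U' K : Subgroup G} {z : G}

theorem coinvInv_toCoinv {V : Type*} [AddCommGroup V] [Module R V] {π : G →* Module.End R V}
    (ht : IsTriangular U M U') {w : V} (hw : ∀ k ∈ K, π k w = w) :
    toCoinv π U' w ∈ coinvInv π M U' K := by
  intro m hm v hv
  rw [toCoinv_rep_congr (ht.conj' m hm.2) hv, hw m hm.1]

/-- If the class of `e_K` in the coinvariants is in the image of the natural map on
`K ∩ M`-invariants, then the powers of left multiplication by `e_{K z K}` stabilise. -/
theorem exists_iterate_idem_eq (ht : IsTriangular U M U') (hK : WellPlaced p U M U' K)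
    (hK' : IsOpenProP p K) (hz : StrictlyPositive U M U' K z)
    (h : toCoinv (leftReg G R) U' (idem μ hp K hK') ∈
      natMap μ hp (leftReg G R) U M U' '' iStarInv μ hp (leftReg G R) U M K) :
    ∃ (x : Hecke G R) (n : ℕ),
      (fun f => conv μ hp (dblIdem μ hp K hK' z) f)^[n] (conv μ hp (dblIdem μ hp K hK' z) x) =
        (fun f => conv μ hp (dblIdem μ hp K hK' z) f)^[n] (idem μ hp K hK') := by
  obtain ⟨v, ⟨⟨hU, -⟩, hM⟩, hv⟩ := h
  simp only [conv_eq_heckeAct]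
  exact exists_iterate_eq ht (isSmooth_leftReg μ (p := p)) hU hK' hK hM hz
    (fun k hk => leftReg_idem μ hp hK' hk) hv

theorem exists_idealsAgree_of_mem_image (ht : IsTriangular U M U') (hK : WellPlaced p U M U' K)
    (hK' : IsOpenProP p K) (hz : StrictlyPositive U M U' K z)
    (h : toCoinv (leftReg G R) U' (idem μ hp K hK') ∈
      natMap μ hp (leftReg G R) U M U' '' iStarInv μ hp (leftReg G R) U M K)
    (h' : toCoinv (leftReg G R) U (idem μ hp K hK') ∈
      natMap μ hp (leftReg G R) U' M U '' iStarInv μ hp (leftReg G R) U' M K) :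
    ∃ m₀, ∀ m ≥ m₀, IdealsAgree μ hp (dblIdem μ hp K hK' z : Hecke G R) m := by
  obtain ⟨x, n, hx⟩ := exists_iterate_idem_eq μ hp ht hK hK' hz h
  obtain ⟨y, k, hy⟩ := exists_iterate_idem_eq μ hp ht.symm hK.symm hK' hz.inv h'
  obtain ⟨y', hy'⟩ := iterate_eq_flip μ hp hK' z hy
  exact exists_idealsAgree μ hp
    (exists_convPow_eq_of_iterate_left μ hp (dblIdem_conv_idem μ hp hK' z) hx)
    (exists_convPow_eq_of_iterate_right μ hp (idem_conv_dblIdem μ hp hK' z) hy')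

theorem toCoinv_idem_mem_image (ht : IsTriangular U M U') (hK : IsOpenProP p K)
    (h : AdjIsoInv μ hp (leftReg G R) U M U' K) :
    toCoinv (leftReg G R) U' (idem μ hp K hK) ∈
      natMap μ hp (leftReg G R) U M U' '' iStarInv μ hp (leftReg G R) U M K :=
  h.surjOn (coinvInv_toCoinv ht fun _ hk => leftReg_idem μ hp hK hk)

end Stabilisation

/-! ### Small well-placed subgroups -/

section Small

variable {G : Type*} [Group G] [TopologicalSpace G] [IsTopologicalGroup G] [MeasurableSpace G]
  [BorelSpace G] {p : ℕ} (μ : MeasureTheory.Measure G) [ProPHaar p μ] {R : Type*} [Ring R]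
  (hp : IsUnit (p : R)) {U M U' K : Subgroup G} {z : G}

include μ in
/-- The `M`-component of an element of `K` close to `1` is close to `1`. -/
theorem exists_component_mem [T2Space G] (ht : IsTriangular U M U') (hU : IsClosed (U : Set G))
    (hM : IsClosed (M : Set G)) (hU' : IsClosed (U' : Set G)) (hK : IsOpenProP p K)
    {A : Set G} (hA : IsOpen A) (hA1 : 1 ∈ A) :
    ∃ N : Subgroup G, IsOpenProP p N ∧ N ≤ K ∧ (∀ k ∈ K, ∀ x ∈ N, k * x * k⁻¹ ∈ N) ∧
      ∀ u ∈ K ⊓ U, ∀ m ∈ K ⊓ M, ∀ u' ∈ K ⊓ U', u * m * u' ∈ N → m ∈ A := by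
  have hc : ∀ {B : Subgroup G}, IsClosed (B : Set G) → IsCompact ((K ⊓ B : Subgroup G) : Set G) :=
    fun hB => hK.2.1.inter_right hB
  have hC : IsCompact ((((K ⊓ U : Subgroup G) : Set G) * (((K ⊓ M : Subgroup G) : Set G) \ A)) *
      ((K ⊓ U' : Subgroup G) : Set G)) :=
    ((hc hU).mul ((hc hM).diff hA)).mul (hc hU')
  -- The products whose `M`-component lies outside `A` form a compact set, which misses `1` by
  -- uniqueness of the factors.
  obtain ⟨J, hJ, hJC⟩ := ProPHaar.small (p := p) (μ := μ) _ (hC.isClosed.isOpen_compl.mem_nhds (by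
    rintro ⟨_, ⟨u, hu, m, hm, rfl⟩, u', hu', e⟩
    obtain ⟨-, rfl, -⟩ := ht.symm.inj u hu.2 m hm.1.2 u' hu'.2 e
    exact hm.2 hA1))
  obtain ⟨N, hN, hNJ, hNK, hn⟩ := hK.exists_normal_le (ProPHaar.prime μ) hJ.1
  refine ⟨N, hN, hNK, hn, fun u hu m hm u' hu' h => ?_⟩
  by_contra hmA
  exact hJC (hNJ h) ⟨u * m, ⟨u, hu, m, ⟨hm, hmA⟩, rfl⟩, u', hu', rfl⟩

/-- The conjugates of `K ∩ U` are decreasing compact sets with intersection `{1}`, so one of them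
lies in any given neighbourhood of `1`. -/
theorem StrictlyPositive.exists_contract [T2Space G] (hz : StrictlyPositive U M U' K z)
    (hU : IsClosed (U : Set G)) (hK : IsCompact (K : Set G)) {s : Set G} (hs : s ∈ 𝓝 (1 : G)) :
    ∃ n : ℕ, ∀ u ∈ K ⊓ U, (z ^ n)⁻¹ * u * z ^ n ∈ s := by
  let W : ℕ → Set G := fun i => (fun u => (z ^ i)⁻¹ * u * z ^ i) '' ((K ⊓ U : Subgroup G) : Set G)
  have hW : Antitone W := by
    apply antitone_nat_of_succ_le
    rintro i _ ⟨u, hu, rfl⟩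
    refine ⟨_, hz.mono u hu, ?_⟩
    simp only [pow_succ', mul_inv_rev, mul_assoc]
  obtain ⟨n, hn⟩ := exists_subset_nhds_of_isCompact (V := W) (U := s) hW.directed_ge
    (fun i => (hK.inter_right hU).image (by fun_prop)) (fun x hx => by
      have : x ∈ ({1} : Set G) := by
        rw [← hz.iInter]
        exact hx
      rw [Set.mem_singleton_iff.1 this]
      exact hs)
  exact ⟨n, fun u hu => hn ⟨u, hu, rfl⟩⟩

/-- If the `M`-components of the elements of `(L ∩ U') (L ∩ U)` lie in the subgroup `A`, then the
elements of `L` with `M`-component in `A` form a subgroup. -/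
def componentSub (L A : Subgroup G) (ht : IsTriangular U M U')
    (hA : ∀ u' ∈ L ⊓ U', ∀ u ∈ L ⊓ U, ∃ v ∈ L ⊓ U, ∃ m ∈ L ⊓ M, ∃ v' ∈ L ⊓ U',
      v * m * v' = u' * u ∧ m ∈ A) : Subgroup G where
  carrier := {k | ∃ u ∈ L ⊓ U, ∃ m ∈ L ⊓ M, ∃ u' ∈ L ⊓ U', u * m * u' = k ∧ m ∈ A}
  one_mem' := ⟨1, one_mem _, 1, one_mem _, 1, one_mem _, by simp, one_mem _⟩
  mul_mem' := by
    rintro _ _ ⟨u, hu, m, hm, u', hu', rfl, hmA⟩ ⟨w, hw, n, hn, w', hw', rfl, hnA⟩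
    obtain ⟨v, hv, k, hk, v', hv', e, hkA⟩ := hA u' hu' w hw
    refine ⟨u * (m * v * m⁻¹), mul_mem hu ⟨?_, ht.conj m hm.2 v hv.2⟩, m * k * n,
      -- Reordering the middle pair `u' * w` as `v * k * v'` and moving `v` and `v'` outwards past
      -- `m` and `n` leaves the `M`-component `m * k * n`.
      mul_mem (mul_mem hm hk) hn, n⁻¹ * v' * n * w', mul_mem ⟨?_, ?_⟩ hw', ?_,
      mul_mem (mul_mem hmA hkA) hnA⟩
    · exact L.mul_mem (L.mul_mem hm.1 hv.1) (L.inv_mem hm.1)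
    · exact L.mul_mem (L.mul_mem (L.inv_mem hn.1) hv'.1) hn.1
    · simpa using ht.conj' n⁻¹ (M.inv_mem hn.2) v' hv'.2
    · have : u * m * u' * (w * n * w') = u * m * (u' * w) * n * w' := by group
      rw [this, ← e]
      group
  inv_mem' := by
    rintro _ ⟨u, hu, m, hm, u', hu', rfl, hmA⟩
    have hw : m⁻¹ * u⁻¹ * m ∈ L ⊓ U :=
      ⟨L.mul_mem (L.mul_mem (L.inv_mem hm.1) (L.inv_mem hu.1)) hm.1,
        by simpa using ht.conj m⁻¹ (M.inv_mem hm.2) u⁻¹ (U.inv_mem hu.2)⟩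
    obtain ⟨v, hv, k, hk, v', hv', e, hkA⟩ := hA u'⁻¹ (inv_mem hu') _ hw
    refine ⟨v, hv, k * m⁻¹, mul_mem hk (inv_mem hm), m * v' * m⁻¹,
      ⟨L.mul_mem (L.mul_mem hm.1 hv'.1) (L.inv_mem hm.1), ht.conj' m hm.2 v' hv'.2⟩, ?_,
      mul_mem hkA (inv_mem hmA)⟩
    have : v * (k * m⁻¹) * (m * v' * m⁻¹) = v * k * v' * m⁻¹ := by group
    rw [this, e]
    group

include μ in
/-- There are well-placed subgroups with arbitrarily small intersection with `M`. -/
theorem exists_wellPlaced_small [T2Space G] (ht : IsTriangular U M U') (hU : IsClosed (U : Set G))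
    (hM : IsClosed (M : Set G)) (hU' : IsClosed (U' : Set G)) (hK : WellPlaced p U M U' K)
    (hz : StrictlyPositive U M U' K z) {s : Set G} (hs : s ∈ 𝓝 (1 : G)) :
    ∃ L : Subgroup G, WellPlaced p U M U' L ∧ ∀ m ∈ L ⊓ M, m ∈ s := by
  obtain ⟨A, hA, hAs⟩ := ProPHaar.small (p := p) (μ := μ) s hs
  obtain ⟨N, hN, hNK, hn, hNA⟩ := exists_component_mem μ ht hU hM hU' hK.1 hA.1 A.one_mem
  obtain ⟨i, hi⟩ := hz.exists_contract hU hK.1.2.1 (hN.1.mem_nhds N.one_mem)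
  -- Intersecting with this conjugate makes the `U`-part of `L` so small that it lies in `N`.
  set L := K ⊓ conjSub (z ^ i)⁻¹ K with hL
  have hzi : (z ^ i)⁻¹ ∈ M := M.inv_mem (M.pow_mem hz.mem i)
  have hdL : Decomposes L U M U' :=
    (Decomposes.inf ht hK.decomposes (hK.decomposes.conjSub _ (ht.conj' _ hzi)
      (fun m hm => mul_mem (mul_mem hzi hm) (inv_mem hzi)) (ht.conj _ hzi))).inv
  have hLU : ∀ u ∈ L ⊓ U, u ∈ N := by
    rintro u ⟨⟨-, hu⟩, huU⟩
    replace hu := mem_conjSub.1 hu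
    rw [inv_inv] at hu
    have := hi (z ^ i * u * (z ^ i)⁻¹) ⟨hu, ht.conj _ (M.pow_mem hz.mem i) u huU⟩
    simpa [mul_assoc] using this
  have hcomp : ∀ u' ∈ L ⊓ U', ∀ u ∈ L ⊓ U, ∃ v ∈ L ⊓ U, ∃ m ∈ L ⊓ M, ∃ v' ∈ L ⊓ U',
      v * m * v' = u' * u ∧ m ∈ A := by
    intro u' hu' u hu
    obtain ⟨v, hv, m, hm, v', hv', e⟩ := hdL (u' * u) (mul_mem hu'.1 hu.1)
    refine ⟨v, hv, m, hm, v', hv', e, hNA v ⟨hv.1.1, hv.2⟩ m ⟨hm.1.1, hm.2⟩ (v' * u'⁻¹)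
      (mul_mem ⟨hv'.1.1, hv'.2⟩ (inv_mem ⟨hu'.1.1, hu'.2⟩)) ?_⟩
    -- The element is now the conjugate `u' * u * u'⁻¹` of `u ∈ N`, and `K` normalises `N`. Moving
    -- `u'⁻¹` into the last factor has not changed the `M`-component.
    rw [← mul_assoc, e]
    exact hn u' hu'.1.1 u (hLU u hu)
  have hopen : IsOpen ((N ⊓ conjSub (z ^ i)⁻¹ K : Subgroup G) : Set G) :=
    hN.1.inter (isOpen_conjSub _ hK.1.1)
  have hle : N ⊓ conjSub (z ^ i)⁻¹ K ≤ componentSub L A ht hcomp := by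
    rintro k ⟨hkN, hk⟩
    obtain ⟨u, hu, m, hm, u', hu', e⟩ := hdL k ⟨hNK hkN, hk⟩
    refine ⟨u, hu, m, hm, u', hu', e, hNA u ⟨hu.1.1, hu.2⟩ m ⟨hm.1.1, hm.2⟩ u' ⟨hu'.1.1, hu'.2⟩ ?_⟩
    rw [e]
    exact hkN
  refine ⟨componentSub L A ht hcomp, hK.of_le ht (ProPHaar.prime μ)
    (Subgroup.isOpen_mono hle hopen) ?_ ?_, ?_⟩
  · rintro _ ⟨u, hu, m, hm, u', hu', rfl, -⟩
    exact mul_mem (mul_mem hu.1.1 hm.1.1) hu'.1.1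
  · rintro _ ⟨u, hu, m, hm, u', hu', rfl, hmA⟩
    refine ⟨u, ⟨⟨u, hu, 1, one_mem _, 1, one_mem _, by simp, one_mem _⟩, hu.2⟩,
      m, ⟨⟨1, one_mem _, m, hm, 1, one_mem _, by simp, hmA⟩, hm.2⟩,
      u', ⟨⟨1, one_mem _, 1, one_mem _, u', hu', by simp, one_mem _⟩, hu'.2⟩, rfl⟩
  · rintro _ ⟨⟨u, hu, m, hm, u', hu', rfl, hmA⟩, h⟩
    obtain ⟨h1, h2, h3⟩ := ht.symm.unique hu.2 (one_mem U) hm.2 h hu'.2 (one_mem U')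
      (b' := u * m * u') (by simp)
    rw [← h2]
    exact hAs hmA

end Small

/-! ### The action of `G` on the roughening -/

section Action

variable {G : Type*} [Group G] [TopologicalSpace G] [IsTopologicalGroup G] [MeasurableSpace G]
  [BorelSpace G] {p : ℕ} (μ : MeasureTheory.Measure G) [ProPHaar p μ] {R : Type*} [Ring R]
  (hp : IsUnit (p : R)) {V : Type*} [AddCommGroup V] [Module R V]
  {π : G →* Module.End R V} {U M U' K L : Subgroup G}

/-- The right side is already `L`-fixed, and `e_L ∘ π g` is constant on orbits of `g⁻¹ L g`. Hence
no volumes need to be compared. -/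
theorem idem_rep_of_conj (hπ : IsSmooth π) (g : G) (hL : IsOpenProP p L)
    (hL' : IsOpenProP p (conjSub g⁻¹ L)) (w : V) :
    heckeAct μ hp π (idem μ hp L hL) (π g w) =
      π g (heckeAct μ hp π (idem μ hp (conjSub g⁻¹ L) hL') w) := by
  have h1 : idemLin μ hp hπ hL (π g (heckeAct μ hp π (idem μ hp (conjSub g⁻¹ L) hL') w)) =
      idemLin μ hp hπ hL (π g w) := by
    refine map_idem_eq μ hp hπ hL' ((idemLin μ hp hπ hL).comp (π g)) fun k hk => ?_
    have h2 : g * k = g * k * g⁻¹ * g := by group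
    have h3 : g * k * g⁻¹ ∈ L := by simpa using mem_conjSub.1 hk
    rw [LinearMap.comp_apply, idemLin_apply, ← rep_mul, h2, rep_mul, idem_rep μ hp hπ hL h3]
    rfl
  rw [← idemLin_apply μ hp hπ, ← h1]
  refine idem_eq_self μ hp hπ hL fun k hk => ?_
  have h2 : k * g = g * (g⁻¹ * k * g) := by group
  have h3 : g⁻¹ * k * g ∈ conjSub g⁻¹ L := mem_conjSub.2 (by simpa [mul_assoc] using hk)
  rw [← rep_mul, h2, rep_mul, rep_idem μ hp hπ hL' h3]

variable {μ hp}

/-- The action of `G` on the roughening. -/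
def roughAct (hπ : IsSmooth π) (g : G) (v : Rough μ hp π) : Rough μ hp π :=
  ⟨fun K => π g (v.1 ⟨conjSub g⁻¹ K.1, K.2.conjSub g⁻¹⟩), by
    constructor
    · intro K x hx
      have h1 : x * g = g * (g⁻¹ * x * g) := by group
      rw [← rep_mul, h1, rep_mul, v.2.1]
      exact mem_conjSub.2 (by simpa [mul_assoc] using hx)
    · intro K L hKL
      rw [idem_rep_of_conj μ hp hπ g L.2 (L.2.conjSub g⁻¹)]
      congr 1
      exact v.2.2 ⟨_, K.2.conjSub g⁻¹⟩ ⟨_, L.2.conjSub g⁻¹⟩ (conjSub_mono hKL)⟩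

theorem roughAct_apply (hπ : IsSmooth π) (g : G) (v : Rough μ hp π)
    (K L : {K : Subgroup G // IsOpenProP p K}) (h : ∀ x, x ∈ K.1 ↔ g * x * g⁻¹ ∈ L.1) :
    (roughAct hπ g v).1 L = π g (v.1 K) := by
  have : K = ⟨conjSub g⁻¹ L.1, L.2.conjSub g⁻¹⟩ := by
    apply Subtype.ext
    ext x
    rw [h x, mem_conjSub, inv_inv]
  rw [this]
  rfl

theorem roughFixed_of_roughAct_eq (hπ : IsSmooth π) {g : G} {v : Rough μ hp π}
    (h : roughAct hπ g v = v) : RoughFixed μ hp π v g := by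
  intro K L hKL
  rw [← roughAct_apply hπ g v K L hKL, h]

theorem RoughFixed.roughAct (hπ : IsSmooth π) {g h : G} {v : Rough μ hp π}
    (hv : RoughFixed μ hp π v (g⁻¹ * h * g)) : RoughFixed μ hp π (roughAct hπ g v) h := by
  intro K L hKL
  have h1 : h * g = g * (g⁻¹ * h * g) := by group
  change π h (π g _) = π g _
  rw [← rep_mul, h1, rep_mul]
  congr 1
  refine hv _ _ fun x => ?_
  rw [mem_conjSub, mem_conjSub, hKL]
  simp [mul_assoc]

theorem roughAct_mem_iStar (ht : IsTriangular U M U') (hπ : IsSmooth π) {m : G} (hm : m ∈ M)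
    {v : Rough μ hp π} (hv : v ∈ iStar μ hp π U M) : roughAct hπ m v ∈ iStar μ hp π U M := by
  obtain ⟨hU, N, hN, h⟩ := hv
  refine ⟨fun u hu => RoughFixed.roughAct hπ (hU _ (by
      simpa using ht.conj m⁻¹ (inv_mem hm) u hu)),
    (fun x => m⁻¹ * x * m) ⁻¹' N, ?_, fun x hx hxN => RoughFixed.roughAct hπ (h _ ?_ hxN)⟩
  · have : Continuous fun x : G => m⁻¹ * x * m := by fun_prop
    exact this.continuousAt.preimage_mem_nhds (by simpa using hN)
  · exact mul_mem (mul_mem (inv_mem hm) hx) hm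

/-- If the natural map is bijective, then preimages of classes of `K`-invariant vectors are
`K ∩ M`-invariant. -/
theorem AdjIso.mem_image (ht : IsTriangular U M U') (hπ : IsSmooth π)
    (hsmall : ∀ s ∈ 𝓝 (1 : G), ∃ L : Subgroup G, WellPlaced p U M U' L ∧ ∀ m ∈ L ⊓ M, m ∈ s)
    (h : AdjIso μ hp π U M U') {w : V} (hw : ∀ k ∈ K, π k w = w) :
    toCoinv π U' w ∈ natMap μ hp π U M U' '' iStarInv μ hp π U M K := by
  obtain ⟨v, hv, hvw⟩ := h.surjOn (Set.mem_univ (toCoinv π U' w))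
  refine ⟨v, ⟨hv, fun m hm => roughFixed_of_roughAct_eq hπ (h.injOn
    (roughAct_mem_iStar ht hπ hm.2 hv) hv ?_)⟩, hvw⟩
  obtain ⟨hU, N, hN, hM⟩ := hv
  obtain ⟨L, hL, hLN⟩ := hsmall N hN
  have hLM : ∀ m ∈ L ⊓ M, RoughFixed μ hp π v m := fun m hm => hM m hm.2 (hLN m hm)
  have h1 := natMap_eq ht hπ hU hL hLM
  -- The image of `m v` is computed with `m L m⁻¹`, where its component is `π m` applied to `v_L`.
  -- Its class is thus that of `π m w = w`, and injectivity gives `m v = v`.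
  have h2 := natMap_eq ht hπ (v := roughAct hπ m v) (L := conjSub m L)
    (roughAct_mem_iStar ht hπ hm.2 ⟨hU, N, hN, hM⟩).1 (hL.conjSub ht hm.2) (fun x hx =>
      RoughFixed.roughAct hπ (hLM _ ⟨mem_conjSub.1 hx.1,
        M.mul_mem (M.mul_mem (M.inv_mem hm.2) hx.2) hm.2⟩))
  rw [h2, hvw, roughAct_apply hπ m v ⟨L, hL.1⟩ ⟨_, (hL.conjSub ht hm.2).1⟩ (fun x => by
    simp [mem_conjSub, mul_assoc]), toCoinv_rep_congr (ht.conj' m hm.2) (h1.symm.trans hvw),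
    hw m hm.1]

end Action

/-! ### Groups of rational points -/

section LocalField

variable (F : Type*) [Field F] [ValuativeRel F] [TopologicalSpace F] [IsNonarchimedeanLocalField F]

theorem localField_t2 : T2Space F := by
  let := IsTopologicalAddGroup.rightUniformSpace F
  have := isUniformAddGroup_of_addCommGroup (G := F)
  infer_instance

theorem localField_totallyDisconnected : TotallyDisconnectedSpace F := by
  have := localField_t2 F
  have : NonarchimedeanAddGroup F := ⟨fun s hs => by
    obtain ⟨r, hr, hrs⟩ := (IsValuativeTopology.hasBasis_nhds_zero' F).mem_iff.1 hs
    refine ⟨⟨(ValuativeRel.valuation F).ltAddSubgroup (Units.mk0 r hr),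
      AddSubgroup.isOpen_of_mem_nhds (g := 0) _ ?_⟩, hrs⟩
    exact (IsValuativeTopology.hasBasis_nhds_zero' F).mem_of_mem hr⟩
  infer_instance

theorem totallyDisconnected_GL (n : ℕ) : TotallyDisconnectedSpace (GL (Fin n) F) := by
  have := localField_totallyDisconnected F
  have h : TotallyDisconnectedSpace (Matrix (Fin n) (Fin n) F) :=
    inferInstanceAs (TotallyDisconnectedSpace (Fin n → Fin n → F))
  refine ⟨isTotallyDisconnected_of_image (f := Units.val) Units.continuous_val.continuousOn
    Units.val_injective ?_⟩
  exact isTotallyDisconnected_of_totallyDisconnectedSpace _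

theorem t2_GL (n : ℕ) : T2Space (GL (Fin n) F) := by
  have := localField_t2 F
  have h : T2Space (Matrix (Fin n) (Fin n) F) := inferInstanceAs (T2Space (Fin n → Fin n → F))
  exact T2Space.of_injective_continuous Units.val_injective Units.continuous_val

variable {F} {k : Type*} [Field k] [Algebra F k] {n : ℕ}

/-- The coefficients lie in `k`, which carries no topology here. Vanishing in `k` is tested by all
`F`-linear functionals, and each of these gives a polynomial condition over `F`. -/
theorem isClosed_setOf_evalGL_eq_zero (f : MvPolynomial (Fin n × Fin n) k) :
    IsClosed {g : GL (Fin n) F | evalGL (Matrix.GeneralLinearGroup.map (algebraMap F k) g) f = 0} := by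
  have := localField_t2 F
  have h : {g : GL (Fin n) F | evalGL (Matrix.GeneralLinearGroup.map (algebraMap F k) g) f = 0} =
      ⋂ φ : Module.Dual F k, {g : GL (Fin n) F | ∑ d ∈ f.support, φ (f.coeff d) *
        ∏ ij ∈ d.support, (g : Matrix (Fin n) (Fin n) F) ij.1 ij.2 ^ d ij = 0} := by
    ext g
    simp only [Set.mem_ofPred_eq, Set.mem_iInter]
    rw [← Module.forall_dual_apply_eq_zero_iff F]
    refine forall_congr' fun φ => ?_
    have : evalGL (Matrix.GeneralLinearGroup.map (algebraMap F k) g) f =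
        ∑ d ∈ f.support, (∏ ij ∈ d.support, (g : Matrix (Fin n) (Fin n) F) ij.1 ij.2 ^ d ij) •
          f.coeff d := by
      rw [evalGL, MvPolynomial.eval_eq]
      refine Finset.sum_congr rfl fun d _ => ?_
      rw [Algebra.smul_def, mul_comm, map_prod]
      simp
    rw [this, map_sum]
    simp only [map_smul, smul_eq_mul, mul_comm]
  rw [h]
  refine isClosed_iInter fun φ => isClosed_eq ?_ continuous_const
  have hc : ∀ ij : Fin n × Fin n,
      Continuous fun g : GL (Fin n) F => (g : Matrix (Fin n) (Fin n) F) ij.1 ij.2 := fun ij =>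
    (Units.continuous_val (M := Matrix (Fin n) (Fin n) F)).matrix_elem ij.1 ij.2
  exact continuous_finsetSum _ fun d _ => continuous_const.mul
    (continuous_finsetProd _ fun ij _ => (hc ij).pow _)

theorem ZariskiClosed.isClosed_ratSub {H L : Subgroup (GL (Fin n) k)}
    (hL : ZariskiClosed (L : Set (GL (Fin n) k))) : IsClosed (ratSub F H L : Set (ratPoints F H)) := by
  obtain ⟨S, hS⟩ := hL
  have h : (ratSub F H L : Set (ratPoints F H)) = Subtype.val ⁻¹' ⋂ f ∈ S,
      {g : GL (Fin n) F | evalGL (Matrix.GeneralLinearGroup.map (algebraMap F k) g) f = 0} := by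
    ext g
    have h1 : g ∈ (ratSub F H L : Set (ratPoints F H)) ↔
      Matrix.GeneralLinearGroup.map (algebraMap F k) g.1 ∈ (L : Set (GL (Fin n) k)) := Iff.rfl
    rw [h1, hS]
    simp
  rw [h]
  exact (isClosed_biInter fun f _ => isClosed_setOf_evalGL_eq_zero f).preimage
    continuous_subtype_val

end LocalField

/-! ### Uniqueness of factors for opposite parabolic subgroups -/

section Triangular

variable {F : Type*} [Field F] {k : Type*} [Field k] [Algebra F k] {n : ℕ}
  {H P P' U M U' : Subgroup (GL (Fin n) k)}

theorem map_algebraMap_injective :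
    Function.Injective (Matrix.GeneralLinearGroup.map (n := Fin n) (algebraMap F k)) := by
  intro g h e
  ext i j
  have := congrArg (fun g : GL (Fin n) k => (g : Matrix (Fin n) (Fin n) k) i j) e
  exact (algebraMap F k).injective (by simpa only [Matrix.GeneralLinearGroup.map_apply] using this)

theorem mem_ratSub {L : Subgroup (GL (Fin n) k)} {g : ratPoints F H} :
    g ∈ ratSub F H L ↔ Matrix.GeneralLinearGroup.map (algebraMap F k) g.1 ∈ L := Iff.rfl

/-- If `u' * m * u = 1`, then `u'` lies in `U'` and in `P ∩ P' = M`, hence is trivial by the Levi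
decomposition of `P'`. The Levi decomposition of `P` then disposes of `u`. -/
theorem IsOppositePair.isTriangular (hP : IsOppositePair F H P P' U M U') :
    IsTriangular (ratSub F H U) (ratSub F H M) (ratSub F H U') where
  conj m hm u hu := by
    rw [mem_ratSub] at *
    simpa using hP.radical.1.2.1 _ (hP.levi.1 hm) _ hu
  conj' m hm u hu := by
    rw [mem_ratSub] at *
    simpa using hP.radical'.1.2.1 _ (hP.levi'.1 hm) _ hu
  inj u' hu' m hm u hu e := by
    have hUP : U ≤ P := hP.radical.1.1
    have hUP' : U' ≤ P' := hP.radical'.1.1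
    have h1 : u' = (m * u)⁻¹ := eq_inv_of_mul_eq_one_left (by rw [← e, mul_assoc])
    have h2 : u' = 1 := by
      have h3 : Matrix.GeneralLinearGroup.map (algebraMap F k) u'.1 ∈ M ⊓ U' := by
        refine ⟨?_, hu'⟩
        rw [hP.inter]
        refine ⟨?_, hUP' hu'⟩
        rw [h1]
        have : (m * u)⁻¹ ∈ ratSub F H P :=
          inv_mem (mul_mem (show m ∈ ratSub F H P from hP.levi.1 hm)
            (show u ∈ ratSub F H P from hUP hu))
        exact this
      rw [hP.levi'.2.2.1, Subgroup.mem_bot] at h3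
      exact Subtype.ext (map_algebraMap_injective (h3.trans (map_one _).symm))
    have h3 : u = m⁻¹ := by
      rw [h2, one_mul] at e
      exact (inv_eq_of_mul_eq_one_right e).symm
    have h4 : u = 1 := by
      have h5 : Matrix.GeneralLinearGroup.map (algebraMap F k) u.1 ∈ M ⊓ U := by
        refine ⟨?_, hu⟩
        have : u ∈ ratSub F H M := by
          rw [h3]
          exact inv_mem hm
        exact this
      rw [hP.levi.2.2.1, Subgroup.mem_bot] at h5
      exact Subtype.ext (map_algebraMap_injective (h5.trans (map_one _).symm))
    refine ⟨h2, ?_, h4⟩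
    rw [h2, h4, one_mul, mul_one] at e
    exact e

end Triangular

/-! ### Small pro-`p` subgroups inside a given one -/

section SmallProP

variable {G : Type*} [Group G] [TopologicalSpace G] [IsTopologicalGroup G]
  [TotallyDisconnectedSpace G] {p : ℕ}

theorem IsOpenProP.exists_subset (hp : p.Prime) {K : Subgroup G} (hK : IsOpenProP p K) {s : Set G}
    (hs : s ∈ 𝓝 (1 : G)) : ∃ L : Subgroup G, IsOpenProP p L ∧ (L : Set G) ⊆ s := by
  have : CompactSpace K := isCompact_iff_compactSpace.1 hK.2.1
  obtain ⟨t, hts, ht, h1⟩ := mem_nhds_iff.1 hs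
  obtain ⟨N, hN⟩ := ProfiniteGrp.exist_openNormalSubgroup_sub_open_nhds_of_one
    (G := K) (U := Subtype.val ⁻¹' t) (ht.preimage continuous_subtype_val) h1
  have hN' : IsOpen ((N.toSubgroup.map K.subtype : Subgroup G) : Set G) := by
    rw [Subgroup.coe_map]
    exact hK.1.isOpenMap_subtype_val _ N.isOpen'
  refine ⟨N.toSubgroup.map K.subtype, hK.mono hp hN' (Subgroup.map_subtype_le _), ?_⟩
  rintro _ ⟨x, hx, rfl⟩
  exact hts (hN hx)

end SmallProP

end StabAdj

end

open StabAdj in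
theorem mainTheorem6
    {F : Type*} [Field F] [ValuativeRel F] [TopologicalSpace F] [IsNonarchimedeanLocalField F]
    (p : ℕ) [Fact p.Prime] [CharP 𝓀[F] p] {n : ℕ}
    (H P P' U M U' : Subgroup (GL (Fin n) (AlgebraicClosure F)))
    (hH : IsConnectedReductive F H) (hP : IsOppositePair F H P P' U M U')
    [MeasurableSpace (ratPoints F H)] [BorelSpace (ratPoints F H)]
    (μ : MeasureTheory.Measure (ratPoints F H)) [μ.IsHaarMeasure]
    (hμ : ∀ K : Subgroup (ratPoints F H), IsOpenProP p K →
      ∃ a : ℤ, μ (K : Set (ratPoints F H)) = (p : ENNReal) ^ a)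
    {R : Type*} [Ring R] (hp : IsUnit (p : R)) :
    (∀ (K : Subgroup (ratPoints F H)) (z : ratPoints F H)
      (hK : WellPlaced p (ratSub F H U) (ratSub F H M) (ratSub F H U') K)
      (_ : StrictlyPositive (ratSub F H U) (ratSub F H M) (ratSub F H U') K z)
      (e : Hecke (ratPoints F H) R) (_ : e = dblIdem μ hp K hK.1 z),
      -- invertibility of the two maps between limits stabilises the ideals
      (Function.Bijective (limMap fun f => conv μ hp e f) →
        Function.Bijective (limMap fun f => conv μ hp f e) →
        ∃ m₀, ∀ m ≥ m₀, IdealsAgree μ hp e m) ∧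
      -- equality of the ideals implies stability on all smooth representations
      (∀ m, IdealsAgree μ hp e m →
        ∀ (V : Type*) [AddCommGroup V] [Module R V] (π : ratPoints F H →* Module.End R V),
          IsSmooth π → IsStable (heckeAct μ hp π (convPow μ hp e m))) ∧
      -- invertibility of the two natural maps on invariants of the regular representation
      (AdjIsoInv μ hp (leftReg (ratPoints F H) R)
          (ratSub F H U) (ratSub F H M) (ratSub F H U') K →
        AdjIsoInv μ hp (leftReg (ratPoints F H) R)
          (ratSub F H U') (ratSub F H M) (ratSub F H U) K →
        ∃ m₀, ∀ m ≥ m₀, IdealsAgree μ hp e m ∧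
          ∀ (V : Type*) [AddCommGroup V] [Module R V] (π : ratPoints F H →* Module.End R V),
            IsSmooth π → IsStable (heckeAct μ hp π (convPow μ hp e m)))) ∧
    -- second adjointness implies stabilisation for all well-placed subgroups
    (AdjIso μ hp (leftReg (ratPoints F H) R)
        (ratSub F H U) (ratSub F H M) (ratSub F H U') →
      AdjIso μ hp (leftReg (ratPoints F H) R)
        (ratSub F H U') (ratSub F H M) (ratSub F H U) →
      ∀ (K : Subgroup (ratPoints F H)) (z : ratPoints F H)
        (hK : WellPlaced p (ratSub F H U) (ratSub F H M) (ratSub F H U') K)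
        (_ : StrictlyPositive (ratSub F H U) (ratSub F H M) (ratSub F H U') K z)
        (e : Hecke (ratPoints F H) R) (_ : e = dblIdem μ hp K hK.1 z),
        ∃ m₀, ∀ m ≥ m₀, IdealsAgree μ hp e m ∧
          ∀ (V : Type*) [AddCommGroup V] [Module R V] (π : ratPoints F H →* Module.End R V),
            IsSmooth π → IsStable (heckeAct μ hp π (convPow μ hp e m))) := by
  have ht := hP.isTriangular
  have hpp : p.Prime := Fact.out
  have hT2 : T2Space (GL (Fin n) F) := t2_GL F n
  have hTD : TotallyDisconnectedSpace (GL (Fin n) F) := totallyDisconnected_GL F n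
  -- One compact open pro-`p` subgroup provides arbitrarily small ones, because it is profinite; the
  -- well-placed `K` plays this role.
  have hHaar : ∀ K : Subgroup (ratPoints F H), IsOpenProP p K → ProPHaar p μ := fun K hK =>
    ⟨hpp, fun s hs => hK.exists_subset hpp hs, hμ, inferInstance⟩
  have hU := hP.radical.1.2.2.1.isClosed_ratSub (F := F) (H := H)
  have hM := hP.levi.2.1.isClosed_ratSub (F := F) (H := H)
  have hU' := hP.radical'.1.2.2.1.isClosed_ratSub (F := F) (H := H)
  refine ⟨fun K z hK hz e he => ?_, fun h1 h2 K z hK hz e he => ?_⟩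
  · subst he
    have := hHaar K hK.1
    have hl := idem_conv_dblIdem μ hp hK.1 z
    have hr := dblIdem_conv_idem μ hp hK.1 z
    refine ⟨fun h1 h2 => exists_idealsAgree_of_surjective μ hp hl hr h1.2 h2.2,
      fun m hm V _ _ π hπ => isStable_of_idealsAgree μ hp hπ hl hr hm, fun h1 h2 => ?_⟩
    obtain ⟨m₀, hm₀⟩ := exists_idealsAgree_of_mem_image μ hp ht hK hK.1 hz
      (toCoinv_idem_mem_image μ hp ht hK.1 h1) (toCoinv_idem_mem_image μ hp ht.symm hK.1 h2)
    exact ⟨m₀, fun m hm => ⟨hm₀ m hm, fun V _ _ π hπ =>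
      isStable_of_idealsAgree μ hp hπ hl hr (hm₀ m hm)⟩⟩
  · subst he
    have := hHaar K hK.1
    have hsm := isSmooth_leftReg (R := R) μ (p := p)
    have hfix : ∀ k ∈ K, leftReg (ratPoints F H) R k (idem μ hp K hK.1) = idem μ hp K hK.1 :=
      fun k hk => leftReg_idem μ hp hK.1 hk
    obtain ⟨m₀, hm₀⟩ := exists_idealsAgree_of_mem_image μ hp ht hK hK.1 hz
      (h1.mem_image ht hsm (fun s hs => exists_wellPlaced_small μ ht hU hM hU' hK hz hs) hfix)
      (h2.mem_image ht.symm hsm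
        (fun s hs => exists_wellPlaced_small μ ht.symm hU' hM hU hK.symm hz.inv hs) hfix)
    exact ⟨m₀, fun m hm => ⟨hm₀ m hm, fun V _ _ π hπ =>
      isStable_of_idealsAgree μ hp hπ (idem_conv_dblIdem μ hp hK.1 z)
        (dblIdem_conv_idem μ hp hK.1 z) (hm₀ m hm)⟩⟩
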